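/- Let $r,\alpha\in\mathbb{R}$, $\sigma>0$, $\lambda\ge 0$, $0\le\mu<1$, $\gamma>0$, $K>0$, $T>0$, and let $z$ be a standard Brownian motion with respect to a filtration $(\mathcal{F}_s)_{s\ge 0}$ on a probability space (that is, $z$ is adapted and $z_u-z_s$ is independent of $\mathcal{F}_s$ for $s\le u$). Put $\delta(T,t)=e^{-r(T-t)}$, $U(x)=1-e^{-\gamma x}$, and $c(y,S)=(1-\mu)Sy$ if $y\ge 0$, $c(y,S)=(1+\lambda)Sy$ if $y<0$. Given $t\in[0,T]$ and $(X,y,S)\in\mathbb{R}\times\mathbb{R}\times\mathbb{R}^+$ (where $\mathbb{R}^+=(0,\infty)$), let $\bar S$ be the solution of $d\bar S=\alpha\bar S\,ds+\sigma\bar S\,dz_s$ on $[t,T]$ with $\bar S(t)=S$. A trading strategy $\pi\in\tau(X,y)$ is a pair $(L,M)$ of adapted, right-continuous, nonnegative, nondecreasing processes with $L(t^-)=M(t^-)=0$ (jumps at time $t$ are allowed), together with the processes $(\bar X,\bar y)$ on $[t,T]$ that satisfy $$d\bar X=r\bar X\,ds-(1+\lambda)\bar S\,dL+(1-\mu)\bar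 S\,dM,\qquad d\bar y=dL-dM,\qquad \bar X(t^-)=X,\ \bar y(t^-)=y.$$ The net wealth at maturity is $W_1(T)=\bar X(T)+c(\bar y(T),\bar S(T))$ in scenario $j=1$ (no option sold), and in scenario $j=w$ (one European call with strike $K$ and maturity $T$ sold) it is $W_w(T)=\bar X(T)+c(\bar y(T),\bar S(T))$ if $\bar S(T)<K$ and $W_w(T)=\bar X(T)+K+c(\bar y(T)-1,\bar S(T))$ if $\bar S(T)\ge K$. For $E>0$ call a state $(X,y,S)$ at time $s$ solvent if $(X+c(y-1,S))e^{r(T-s)}>-E$. The value function with bankruptcy state is $$V_j^{B_E}(t,X,y,S)=\sup_{\pi\in\tau(X,y)}\mathbb{E}\bigl[U(W_j(T))\mathbf{1}_{A_\pi}+(1-e^{\gamma E})\mathbf{1}_{A_\pi^c}\bigr]$$ if $(X,y,S)$ is solvent at time $t$, where $A_\pi$ is the event that $(\bar X(s),\bar y(s),\bar S(s))$ is solvent at every time $s\in[t,T]$; and $V_j^{B_E}(t,X,y,S)=1-e^{\gamma E}$ otherwise. For $X_0\in\mathbb{R}$ the reduced value function $Q_j^{B_{E,X_0}}(t,y,S)$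 is defined by $$V_j^{B_E}(t,X_0,y,S)=1-\exp\Bigl(-\gamma\frac{X_0}{\delta(T,t)}\Bigr)Q_j^{B_{E,X_0}}(t,y,S).$$ Then for every $X_0\in\mathbb{R}$ and $E_0>0$ there is $M=M(X_0,E_0)\ge 0$ such that $$0<Q_j^{B_{E_0,X_0}}(t,y,S)\le M\qquad\text{for all }(t,y,S)\in[0,T]\times\mathbb{R}\times\mathbb{R}^+\text{ and } j\in\{1,w\}.$$ -/

import Mathlib

open MeasureTheory ProbabilityTheory
open scoped NNReal

/-- The constants of the market: interest rate `r`, rate of return `α` and volatility `σ` of the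
stock, proportional costs `lam` (purchases) and `mu` (sales), risk aversion `γ`, strike `K` and
maturity `T`. -/
structure MarketParams where
  r : ℝ
  α : ℝ
  σ : ℝ
  lam : ℝ
  mu : ℝ
  γ : ℝ
  K : ℝ
  T : ℝ

/-- The two scenarios: `one` (no option has been sold) and `w` (one European call has been sold). -/
inductive Scenario where
  | one : Scenario
  | w : Scenario

/-- `z` is a standard Brownian motion with respect to the filtration `F`. -/
structure IsFilteredBrownian {Ω : Type*} {mΩ : MeasurableSpace Ω} (P : Measure Ω)
    (F : Filtration ℝ≥0 mΩ) (z : ℝ≥0 → Ω → ℝ) : Prop where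
  isBrownian : IsBrownianReal z P
  adapted : ∀ u : ℝ≥0, Measurable[F u] (z u)
  indep_increments : ∀ s u : ℝ≥0, s ≤ u →
    Indep (F s) (MeasurableSpace.comap (fun ω ↦ z u ω - z s ω) inferInstance) P

noncomputable section

namespace MarketParams

variable (p : MarketParams)

/-- Discount factor `δ(T,t)`. -/
def discount (t : ℝ) : ℝ := Real.exp (-(p.r * (p.T - t)))

/-- Exponential utility. -/
def utility (x : ℝ) : ℝ := 1 - Real.exp (-(p.γ * x))

/-- Liquidated cash value `c(y,S)` of `y` shares at price `S`. -/
def cashValue (y S : ℝ) : ℝ :=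
  if 0 ≤ y then (1 - p.mu) * S * y else (1 + p.lam) * S * y

/-- Net wealth at maturity `W_j(T)`, as a function of the terminal bank account, number of shares
and stock price. -/
def terminalWealth (j : Scenario) (X y S : ℝ) : ℝ :=
  match j with
  | .one => X + p.cashValue y S
  | .w => if S < p.K then X + p.cashValue y S else X + p.K + p.cashValue (y - 1) S

/-- The state `(X,y,S)`, attained at time `t`, satisfies the solvency constraint with bound `E`. -/
def Solvent (E t X y S : ℝ) : Prop :=
  -E < (X + p.cashValue (y - 1) S) * Real.exp (p.r * (p.T - t))

variable {Ω : Type*} {mΩ : MeasurableSpace Ω}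

/-- The stock price at time `s`, started from `S` at time `t`: the geometric Brownian motion
that solves `dS = α S ds + σ S dz`. -/
def stock (z : ℝ≥0 → Ω → ℝ) (t S s : ℝ) (ω : Ω) : ℝ :=
  S * Real.exp ((p.α - p.σ ^ 2 / 2) * (s - t) + p.σ * (z s.toNNReal ω - z t.toNNReal ω))

/-- A trading strategy on `[t,T]` started from the position `(X,y)` just before time `t`, when the
stock price at time `t` is `S`. `L` and `M` are the cumulative numbers of shares bought and sold:
each path is nondecreasing and right-continuous and vanishes before `t`, so that a jump at `t`
itself is an atom at `t` of the associated Stieltjes measure. No solvency condition is imposed. -/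
structure Strategy (P : Measure Ω) (F : Filtration ℝ≥0 mΩ) (z : ℝ≥0 → Ω → ℝ)
    (t X y S : ℝ) where
  L : Ω → StieltjesFunction ℝ
  M : Ω → StieltjesFunction ℝ
  bank : ℝ → Ω → ℝ
  shares : ℝ → Ω → ℝ
  L_before : ∀ ω, ∀ s < t, L ω s = 0
  M_before : ∀ ω, ∀ s < t, M ω s = 0
  L_adapted : ∀ s ∈ Set.Icc t p.T, Measurable[F s.toNNReal] (fun ω ↦ L ω s)
  M_adapted : ∀ s ∈ Set.Icc t p.T, Measurable[F s.toNNReal] (fun ω ↦ M ω s)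
  bank_adapted : ∀ s ∈ Set.Icc t p.T, Measurable[F s.toNNReal] (bank s)
  bank_eq : ∀ᵐ ω ∂P, ∀ s ∈ Set.Icc t p.T,
    bank s ω = X + (∫ u in t..s, p.r * bank u ω)
      - (1 + p.lam) * (∫ u in Set.Icc t s, p.stock z t S u ω ∂(L ω).measure)
      + (1 - p.mu) * (∫ u in Set.Icc t s, p.stock z t S u ω ∂(M ω).measure)
  shares_eq : ∀ ω, ∀ s ∈ Set.Icc t p.T, shares s ω = y + L ω s - M ω s

open Classical in
/-- Utility obtained along the path `ω`: the utility of the terminal wealth if the investor is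
solvent at all times of `[t,T]`, and the residual bankruptcy utility `1 - exp (γ E)` if at some time
the strategy has led outside the solvency region. -/
def outcome {P : Measure Ω} {F : Filtration ℝ≥0 mΩ} {z : ℝ≥0 → Ω → ℝ} {t X y S : ℝ}
    (j : Scenario) (E : ℝ) (π : p.Strategy P F z t X y S) (ω : Ω) : ℝ :=
  if ∀ s ∈ Set.Icc t p.T, p.Solvent E s (π.bank s ω) (π.shares s ω) (p.stock z t S s ω) then
    p.utility (p.terminalWealth j (π.bank p.T ω) (π.shares p.T ω) (p.stock z t S p.T ω))
  else 1 - Real.exp (p.γ * E)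

open Classical in
/-- The value function `V^{B_E}_j(t,X,y,S)` with bankruptcy state. -/
def valueB (P : Measure Ω) (F : Filtration ℝ≥0 mΩ) (z : ℝ≥0 → Ω → ℝ)
    (j : Scenario) (E t X y S : ℝ) : ℝ :=
  if p.Solvent E t X y S then
    ⨆ π : p.Strategy P F z t X y S, ∫ ω, p.outcome j E π ω ∂P
  else 1 - Real.exp (p.γ * E)

/-- The reduced value function `Q^{B_{E,X₀}}_j(t,y,S)`, that is, the solution `Q` of
`V^{B_E}_j(t,X₀,y,S) = 1 - exp (-γ X₀ / δ(T,t)) * Q`. -/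
def reducedB (P : Measure Ω) (F : Filtration ℝ≥0 mΩ) (z : ℝ≥0 → Ω → ℝ)
    (j : Scenario) (E X₀ t y S : ℝ) : ℝ :=
  (1 - p.valueB P F z j E t X₀ y S) / Real.exp (-(p.γ * (X₀ / p.discount t)))

end MarketParams

end

/-! The upper bound is elementary. A path that stays solvent ends with `W_j(T) > -E`, and bankruptcy
pays exactly `1 - exp (γ E)`, so no outcome is below that value. Dividing by `exp (-γ X₀ / δ)` costs
a factor bounded in `t`.

Positivity of `Q` means `V < 1`, so expected utility must stay away from `1` uniformly in the
strategy (`exists_integral_outcome_le`). If it came too close to `1`, then outside an event of small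
probability the strategy would remain solvent and end with large wealth. Since costs only reduce
wealth, a frictionless portfolio with gains bounded below would then have a large final gain with
probability near `1`. This is impossible under the martingale measure, where such gains have mean
zero. The density has a finite second moment, so the obstruction carries over to `P`: a moderate
final gain has probability at least `1 / (4 exp (θ² (T - t)))`.

No stochastic integral is needed. Trading has finite variation, so solving the bank equation
pathwise (`discounted_bank_eq`) and summing by parts (`abs_gain_sub_riemann_le`) bounds wealth by
the gain of a portfolio rebalanced on a fine grid, up to an error of `1`. The grid gain is truncated
so that its mean under the martingale density is zero. The truncated loss can overshoot its level by
one step only, and fourth moments of the price increments make this overshoot negligible as the mesh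
shrinks (`le_measure_truncatedGain_lt`). The grid depends on the strategy, but the probability bound
does not. -/

/-! ### The bank account equation, solved path by path -/

/-- The linear integral equation `e s = r ∫ₜˢ e` has only the zero solution. -/
theorem eq_zero_of_eq_mul_integral {r t s : ℝ} {e : ℝ → ℝ} (hts : t ≤ s)
    (hint : IntervalIntegrable e volume t s)
    (he : ∀ v ∈ Set.Icc t s, e v = r * ∫ u in t..v, e u) : ∀ v ∈ Set.Icc t s, e v = 0 := by
  set I : ℝ → ℝ := fun v ↦ ∫ u in t..v, e u
  have hI : ContinuousOn I (Set.Icc t s) := by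
    have := intervalIntegral.continuousOn_primitive_interval' hint (Set.left_mem_uIcc)
    rwa [Set.uIcc_of_le hts] at this
  -- Clamping to `[t, s]` extends the primitive continuously to `ℝ`, so that `G` is differentiable
  -- and Grönwall's inequality applies.
  set J : ℝ → ℝ := fun v ↦ I (Set.projIcc t s hts v)
  have hJ : Continuous J := by
    have := hI.domRestrict.comp (continuous_projIcc (h := hts))
    exact this
  have hJI : ∀ v ∈ Set.Icc t s, J v = I v := fun v hv ↦ by
    simp only [J, Set.projIcc_of_mem hts hv]
  set G : ℝ → ℝ := fun v ↦ ∫ u in t..v, r * J u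
  have hG : ∀ v, HasDerivAt G (r * J v) v := fun v ↦
    (by fun_prop : Continuous fun u ↦ r * J u).integral_hasStrictDerivAt t v |>.hasDerivAt
  have hGI : ∀ v ∈ Set.Icc t s, G v = I v := fun v hv ↦ by
    refine intervalIntegral.integral_congr fun u hu ↦ ?_
    rw [Set.uIcc_of_le hv.1] at hu
    have hu' : u ∈ Set.Icc t s := ⟨hu.1, hu.2.trans hv.2⟩
    change r * J u = e u
    rw [hJI u hu', he u hu']
  have hzero := eq_zero_of_abs_deriv_le_mul_abs_self_of_eq_zero_right (f := G)
    (f' := fun v ↦ r * J v) (K := |r|) (a := t) (b := s)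
    (fun v _ ↦ (hG v).continuousAt.continuousWithinAt)
    (fun v _ ↦ (hG v).hasDerivWithinAt) (by simp [G]) (fun v hv ↦ by
      have hv' := Set.Ico_subset_Icc_self hv
      rw [hJI v hv', ← hGI v hv', norm_mul, Real.norm_eq_abs r])
  intro v hv
  rw [he v hv]
  have : I v = 0 := by rw [← hGI v hv]; exact hzero v hv
  change r * I v = 0
  rw [this, mul_zero]

/-- A solution of the linear integral equation `b s = r ∫ₜˢ b + V s` agrees with every integrable
solution; no integrability of `b` is assumed. -/
theorem eq_of_linear_integral_eq {r t T : ℝ} {b Φ V : ℝ → ℝ} (htT : t ≤ T)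
    (hΦ : IntervalIntegrable Φ volume t T) (hV : IntervalIntegrable V volume t T)
    (hb : ∀ s ∈ Set.Icc t T, b s = (∫ u in t..s, r * b u) + V s)
    (hΦeq : ∀ s ∈ Set.Icc t T, Φ s = (∫ u in t..s, r * Φ u) + V s) :
    ∀ s ∈ Set.Icc t T, b s = Φ s := by
  have key : ∀ s ∈ Set.Icc t T, IntervalIntegrable b volume t s → b s = Φ s := by
    intro s hs hbs
    have hsub : ∀ v ∈ Set.Icc t s, Set.uIcc t v ⊆ Set.uIcc t s := fun v hv ↦ by
      rw [Set.uIcc_of_le hv.1, Set.uIcc_of_le hs.1]; exact Set.Icc_subset_Icc_right hv.2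
    have hΦs : IntervalIntegrable Φ volume t s := hΦ.mono_set (by
      rw [Set.uIcc_of_le hs.1, Set.uIcc_of_le htT]; exact Set.Icc_subset_Icc_right hs.2)
    have := eq_zero_of_eq_mul_integral (r := r) (e := fun u ↦ b u - Φ u) hs.1 (hbs.sub hΦs)
      (fun v hv ↦ by
        have hv' : v ∈ Set.Icc t T := ⟨hv.1, hv.2.trans hs.2⟩
        rw [intervalIntegral.integral_sub (hbs.mono_set (hsub v hv)) (hΦs.mono_set (hsub v hv)),
          hb v hv', hΦeq v hv', intervalIntegral.integral_const_mul,
          intervalIntegral.integral_const_mul]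
        ring) s ⟨hs.1, le_rfl⟩
    linarith
  suffices h : IntervalIntegrable b volume t T by
    intro s hs
    exact key s hs (h.mono_set (by
      rw [Set.uIcc_of_le hs.1, Set.uIcc_of_le htT]; exact Set.Icc_subset_Icc_right hs.2))
  rcases eq_or_ne r 0 with rfl | hr
  · refine hV.congr fun s hs ↦ ?_
    rw [Set.uIoc_of_le htT] at hs
    have := hb s (Set.Ioc_subset_Icc_self hs)
    simp at this
    exact this.symm
  -- `J` is an interval on which `b = Φ`. Off `J` the integral of `r * b` takes the default value
  -- `0`, so `b = V` there. Either way `b` agrees with an integrable function.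
  set J : Set ℝ := {s | t ≤ s ∧ IntervalIntegrable b volume t s}
  have hJ : J.OrdConnected := ⟨fun x hx y hy v hv ↦ ⟨hx.1.trans hv.1, hy.2.mono_set (by
      rw [Set.uIcc_of_le (hx.1.trans hv.1), Set.uIcc_of_le hy.1]
      exact Set.Icc_subset_Icc_right hv.2)⟩⟩
  have hJm : MeasurableSet J := hJ.measurableSet
  rw [intervalIntegrable_iff_integrableOn_Ioc_of_le htT] at hΦ hV ⊢
  refine ((hΦ.indicator hJm).add (hV.indicator hJm.compl)).congr_fun (fun s hs ↦ ?_)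
    measurableSet_Ioc
  have hs' := Set.Ioc_subset_Icc_self hs
  by_cases hsJ : s ∈ J
  · simp [hsJ, key s hs' hsJ.2]
  · have hni : ¬ IntervalIntegrable (fun u ↦ r * b u) volume t s := fun h ↦ hsJ ⟨hs'.1, by
      simpa [← mul_assoc, inv_mul_cancel₀ hr] using h.const_mul r⁻¹⟩
    simp [hsJ, hb s hs', intervalIntegral.integral_undef hni]

/-- Variation of constants for a forcing term `∫_{[t,s]} g dν`. -/
theorem integral_exp_convolution {r t s : ℝ} (hts : t ≤ s) {g : ℝ → ℝ} (hg : Continuous g)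
    (ν : Measure ℝ) [IsLocallyFiniteMeasure ν] :
    IntervalIntegrable (fun v ↦ ∫ u in Set.Icc t v, Real.exp (r * (v - u)) * g u ∂ν) volume t s ∧
    (∫ v in t..s, r * ∫ u in Set.Icc t v, Real.exp (r * (v - u)) * g u ∂ν) =
      (∫ u in Set.Icc t s, Real.exp (r * (s - u)) * g u ∂ν) - ∫ u in Set.Icc t s, g u ∂ν := by
  -- The variable endpoint moves into an indicator, so that Fubini applies on the triangle `u ≤ v`.
  have hsw : ∀ v ∈ Set.Ioc t s, (∫ u in Set.Icc t v, Real.exp (r * (v - u)) * g u ∂ν) =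
      ∫ u in Set.Icc t s, (Set.Ici u).indicator (fun v ↦ Real.exp (r * (v - u)) * g u) v ∂ν := by
    intro v hv
    have : ∀ u, (Set.Ici u).indicator (fun v ↦ Real.exp (r * (v - u)) * g u) v =
        (Set.Iic v).indicator (fun u ↦ Real.exp (r * (v - u)) * g u) u := fun u ↦ by
      by_cases h : u ≤ v <;> simp [h]
    simp_rw [this]
    rw [setIntegral_indicator measurableSet_Iic]
    congr 2
    ext u
    simp only [Set.mem_Icc, Set.mem_inter_iff, Set.mem_Iic]
    exact ⟨fun h ↦ ⟨⟨h.1, h.2.trans hv.2⟩, h.2⟩, fun h ↦ ⟨h.1.1, h.2⟩⟩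
  have hint : Integrable (fun q : ℝ × ℝ ↦
      (Set.Ici q.2).indicator (fun v ↦ Real.exp (r * (v - q.2)) * g q.2) q.1)
      ((volume.restrict (Set.Ioc t s)).prod (ν.restrict (Set.Icc t s))) := by
    have h1 : IntegrableOn (fun q : ℝ × ℝ ↦ Real.exp (r * (q.1 - q.2)) * g q.2)
        (Set.Icc t s ×ˢ Set.Icc t s) ((volume : Measure ℝ).prod ν) :=
      ContinuousOn.integrableOn_compact (isCompact_Icc.prod isCompact_Icc) (by fun_prop)
    have h2 : Integrable (fun q : ℝ × ℝ ↦ Real.exp (r * (q.1 - q.2)) * g q.2)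
        ((volume.restrict (Set.Ioc t s)).prod (ν.restrict (Set.Icc t s))) := by
      rw [Measure.prod_restrict]
      exact h1.mono_set (Set.prod_mono Set.Ioc_subset_Icc_self subset_rfl)
    have h3 := h2.indicator (s := {q : ℝ × ℝ | q.2 ≤ q.1})
      (measurableSet_le measurable_snd measurable_fst)
    exact h3
  constructor
  · rw [intervalIntegrable_iff_integrableOn_Ioc_of_le hts]
    exact IntegrableOn.congr_fun hint.integral_prod_left (fun v hv ↦ (hsw v hv).symm)
      measurableSet_Ioc
  · rw [intervalIntegral.integral_of_le hts, integral_const_mul,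
      setIntegral_congr_fun measurableSet_Ioc hsw, integral_integral_swap hint,
      ← integral_sub, ← integral_const_mul]
    · refine setIntegral_congr_fun measurableSet_Icc fun u hu ↦ ?_
      change r * ∫ v in Set.Ioc t s, (Set.Ici u).indicator (fun v ↦ Real.exp (r * (v - u)) * g u) v
        = Real.exp (r * (s - u)) * g u - g u
      have hcalc : ∫ v in u..s, r * (Real.exp (r * (v - u)) * g u) =
          Real.exp (r * (s - u)) * g u - g u := by
        rw [intervalIntegral.integral_eq_sub_of_hasDerivAt
          (f := fun v ↦ Real.exp (r * (v - u)) * g u)]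
        · simp
        · intro v _
          have h := ((((hasDerivAt_id v).sub_const u).const_mul r).exp).mul_const (g u)
          refine h.congr_deriv ?_
          simp only [id_eq]
          ring
        · exact (by fun_prop : Continuous fun v ↦
            r * (Real.exp (r * (v - u)) * g u)).intervalIntegrable _ _
      rw [← hcalc, intervalIntegral.integral_const_mul, setIntegral_indicator measurableSet_Ici,
        intervalIntegral.integral_of_le hu.2]
      congr 1
      refine setIntegral_congr_set ?_
      have : (Set.Ioc u s : Set ℝ) =ᵐ[volume] Set.Icc u s := Ioc_ae_eq_Icc
      refine Filter.EventuallyEq.trans ?_ this.symm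
      have h' : (Set.Ioc t s : Set ℝ) =ᵐ[volume] Set.Icc t s := Ioc_ae_eq_Icc
      have hset : Set.Icc t s ∩ Set.Ici u = Set.Icc u s := by
        ext v
        simp only [Set.mem_inter_iff, Set.mem_Icc, Set.mem_Ici]
        exact ⟨fun h ↦ ⟨h.2, h.1.2⟩, fun h ↦ ⟨⟨hu.1.trans h.1, h.2⟩, h.1⟩⟩
      exact (h'.inter (Filter.EventuallyEq.refl _ (Set.Ici u))).trans
        (Filter.EventuallyEq.of_eq hset)
    · exact ContinuousOn.integrableOn_compact isCompact_Icc (by fun_prop)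
    · exact ContinuousOn.integrableOn_compact isCompact_Icc (by fun_prop)

/-- The bank account equation in discounted form. -/
theorem discounted_bank_eq {r t T X c d : ℝ} (htT : t ≤ T) {g b : ℝ → ℝ} (hg : Continuous g)
    (ν ρ : Measure ℝ) [IsLocallyFiniteMeasure ν] [IsLocallyFiniteMeasure ρ]
    (hb : ∀ s ∈ Set.Icc t T, b s = X + (∫ u in t..s, r * b u)
      - c * (∫ u in Set.Icc t s, g u ∂ν) + d * (∫ u in Set.Icc t s, g u ∂ρ)) :
    ∀ s ∈ Set.Icc t T, Real.exp (-(r * (s - t))) * b s = X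
      - c * (∫ u in Set.Icc t s, Real.exp (-(r * (u - t))) * g u ∂ν)
      + d * (∫ u in Set.Icc t s, Real.exp (-(r * (u - t))) * g u ∂ρ) := by
  set f : Measure ℝ → ℝ → ℝ := fun κ s ↦ ∫ u in Set.Icc t s, Real.exp (r * (s - u)) * g u ∂κ
  set V : Measure ℝ → ℝ → ℝ := fun κ s ↦ ∫ u in Set.Icc t s, g u ∂κ
  have hVint : ∀ κ : Measure ℝ, [IsLocallyFiniteMeasure κ] →
      IntervalIntegrable (V κ) volume t T := fun κ _ ↦ by
    -- For `r = 0` the kernel is `1`.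
    have := (integral_exp_convolution (r := 0) htT hg κ).1
    simpa using this
  have hfint : ∀ κ : Measure ℝ, [IsLocallyFiniteMeasure κ] → ∀ s, t ≤ s →
      IntervalIntegrable (f κ) volume t s := fun κ _ s hs ↦ (integral_exp_convolution hs hg κ).1
  have hfeq : ∀ κ : Measure ℝ, [IsLocallyFiniteMeasure κ] → ∀ s, t ≤ s →
      (∫ v in t..s, r * f κ v) = f κ s - V κ s :=
    fun κ _ s hs ↦ (integral_exp_convolution hs hg κ).2
  have hexp : Continuous fun s ↦ X * Real.exp (r * (s - t)) := by fun_prop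
  have hexpint : ∀ s, (∫ v in t..s, r * (X * Real.exp (r * (v - t)))) =
      X * Real.exp (r * (s - t)) - X := fun s ↦ by
    rw [intervalIntegral.integral_eq_sub_of_hasDerivAt (f := fun v ↦ X * Real.exp (r * (v - t)))]
    · simp
    · intro v _
      have h := ((((hasDerivAt_id v).sub_const t).const_mul r).exp).const_mul X
      refine h.congr_deriv ?_
      simp only [id_eq]
      ring
    · exact (continuous_const.mul hexp).intervalIntegrable _ _
  -- The variation of constants solution, to be identified with `b`.
  set Φ : ℝ → ℝ := fun s ↦ X * Real.exp (r * (s - t)) - c * f ν s + d * f ρ s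
  have hmain := eq_of_linear_integral_eq (r := r) (b := b) (Φ := Φ)
    (V := fun s ↦ X - c * V ν s + d * V ρ s) htT
    (((hexp.intervalIntegrable _ _).sub ((hfint ν T htT).const_mul c)).add
      ((hfint ρ T htT).const_mul d))
    (((continuous_const.intervalIntegrable _ _).sub ((hVint ν).const_mul c)).add
      ((hVint ρ).const_mul d))
    (fun s hs ↦ by rw [hb s hs]; ring)
    (fun s hs ↦ by
      have h1 : (fun u ↦ r * Φ u) = fun u ↦ r * (X * Real.exp (r * (u - t)))
          - c * (r * f ν u) + d * (r * f ρ u) := by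
        ext u; simp only [Φ]; ring
      rw [h1, intervalIntegral.integral_add, intervalIntegral.integral_sub, hexpint,
        intervalIntegral.integral_const_mul c, intervalIntegral.integral_const_mul d,
        hfeq ν s hs.1, hfeq ρ s hs.1]
      · simp only [Φ]; ring
      · exact (continuous_const.mul hexp).intervalIntegrable _ _
      · exact ((hfint ν s hs.1).const_mul r).const_mul c
      · exact ((continuous_const.mul hexp).intervalIntegrable _ _).sub
          (((hfint ν s hs.1).const_mul r).const_mul c)
      · exact ((hfint ρ s hs.1).const_mul r).const_mul d)
  intro s hs
  have hdisc : ∀ κ : Measure ℝ, Real.exp (-(r * (s - t))) * f κ s =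
      ∫ u in Set.Icc t s, Real.exp (-(r * (u - t))) * g u ∂κ := fun κ ↦ by
    simp only [f]
    rw [← integral_const_mul]
    congr 1
    ext u
    rw [← mul_assoc, ← Real.exp_add]
    ring_nf
  have hone : Real.exp (-(r * (s - t))) * Real.exp (r * (s - t)) = 1 := by
    rw [← Real.exp_add]; simp
  rw [hmain s hs, ← hdisc, ← hdisc]
  simp only [Φ]
  linear_combination X * hone

/-! ### Summation by parts on a grid -/

/-- Riemann sum approximation, on a grid of mesh `h`, of the gain `∫ (A - A u) dL u`. -/
theorem abs_gain_sub_riemann_le {t h ω : ℝ} (hh : 0 ≤ h) {A : ℝ → ℝ} (hA : Continuous A)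
    (L : StieltjesFunction ℝ) (hL : ∀ s < t, L s = 0) (n : ℕ)
    (hosc : ∀ u ∈ Set.Icc t (t + n * h), ∀ v ∈ Set.Icc t (t + n * h),
      |u - v| ≤ h → |A u - A v| ≤ ω) :
    ∀ m ≤ n, |L (t + m * h) * A (t + m * h) - (∫ u in Set.Icc t (t + m * h), A u ∂L.measure)
      - ∑ k ∈ Finset.range m, L (t + k * h) * (A (t + (k + 1 : ℕ) * h) - A (t + k * h))|
      ≤ ω * L (t + m * h) := by
  -- Hence `{t}` has mass `L t`: the initial jump belongs to the integral and contributes no error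
  -- at `m = 0`.
  have hleft : Function.leftLim L t = 0 := by
    refine leftLim_eq_of_tendsto ?_
    refine tendsto_const_nhds.congr' ?_
    filter_upwards [self_mem_nhdsWithin] with s hs using (hL s hs).symm
  have hint : ∀ a b, IntegrableOn A (Set.Icc a b) L.measure := fun a b ↦
    hA.continuousOn.integrableOn_compact isCompact_Icc
  have hω : 0 ≤ ω := by
    have ht : t ∈ Set.Icc t (t + n * h) := ⟨le_rfl, by nlinarith [mul_nonneg n.cast_nonneg hh]⟩
    have := hosc t ht t ht (by simpa using hh)
    simpa using this
  intro m
  induction m with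
  | zero =>
    intro _
    have hLt : 0 ≤ L t := by
      rw [← hleft]; exact L.mono.leftLim_le le_rfl
    simp only [Nat.cast_zero, zero_mul, add_zero, Set.Icc_self, Finset.range_zero,
      Finset.sum_empty, sub_zero]
    rw [integral_singleton, Measure.real, L.measure_singleton, hleft, sub_zero,
      ENNReal.toReal_ofReal hLt, smul_eq_mul, sub_self, abs_zero]
    exact mul_nonneg hω hLt
  | succ m ih =>
    intro hm
    have ih := ih (by omega)
    set a := t + m * h
    set b := t + (m + 1 : ℕ) * h
    have hab : b = a + h := by simp only [a, b]; push_cast; ring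
    have hle : a ≤ b := by linarith
    have hta : t ≤ a := by simp only [a]; nlinarith [mul_nonneg (m.cast_nonneg (α := ℝ)) hh]
    have hbn : b ≤ t + n * h := by
      simp only [b]
      have : ((m + 1 : ℕ) : ℝ) ≤ n := by exact_mod_cast hm
      nlinarith
    have hsplit : ∫ u in Set.Icc t b, A u ∂L.measure =
        (∫ u in Set.Icc t a, A u ∂L.measure) + ∫ u in Set.Ioc a b, A u ∂L.measure := by
      rw [← Set.Icc_union_Ioc_eq_Icc hta hle, setIntegral_union _ measurableSet_Ioc (hint _ _)
        ((hint a b).mono_set Set.Ioc_subset_Icc_self)]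
      exact Set.disjoint_left.2 fun u hu hu' ↦ absurd hu.2 (not_le.2 hu'.1)
    have hmeas : L.measure.real (Set.Ioc a b) = L b - L a := by
      rw [Measure.real, L.measure_Ioc, ENNReal.toReal_ofReal (sub_nonneg.2 (L.mono hle))]
    have hstep : |(L b - L a) * A b - ∫ u in Set.Ioc a b, A u ∂L.measure| ≤ ω * (L b - L a) := by
      have hfin : L.measure (Set.Ioc a b) < ⊤ := by rw [L.measure_Ioc]; exact ENNReal.ofReal_lt_top
      have heq : (L b - L a) * A b - ∫ u in Set.Ioc a b, A u ∂L.measure =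
          ∫ u in Set.Ioc a b, (A b - A u) ∂L.measure := by
        rw [integral_sub, setIntegral_const, hmeas, smul_eq_mul]
        · exact integrableOn_const hfin.ne
        · exact (hint a b).mono_set Set.Ioc_subset_Icc_self
      rw [heq, ← hmeas, ← Real.norm_eq_abs]
      refine norm_setIntegral_le_of_norm_le_const hfin fun u hu ↦ ?_
      refine hosc b ⟨hta.trans hle, hbn⟩ u ⟨hta.trans hu.1.le, hu.2.trans hbn⟩ ?_
      rw [abs_of_nonneg (by linarith [hu.2])]
      linarith [hu.1]
    rw [Finset.sum_range_succ, hsplit]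
    have hsum := abs_add_le (L a * A a - (∫ u in Set.Icc t a, A u ∂L.measure)
      - ∑ k ∈ Finset.range m, L (t + k * h) * (A (t + (k + 1 : ℕ) * h) - A (t + k * h)))
      ((L b - L a) * A b - ∫ u in Set.Ioc a b, A u ∂L.measure)
    have hcongr : L b * A b - ((∫ u in Set.Icc t a, A u ∂L.measure) +
        ∫ u in Set.Ioc a b, A u ∂L.measure) -
        (∑ k ∈ Finset.range m, L (t + k * h) * (A (t + (k + 1 : ℕ) * h) - A (t + k * h)) +
          L a * (A b - A a)) =
        (L a * A a - (∫ u in Set.Icc t a, A u ∂L.measure)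
      - ∑ k ∈ Finset.range m, L (t + k * h) * (A (t + (k + 1 : ℕ) * h) - A (t + k * h))) +
      ((L b - L a) * A b - ∫ u in Set.Ioc a b, A u ∂L.measure) := by ring
    rw [hcongr]
    linarith

/-! ### Exponentials of Brownian increments and moments under the martingale density -/

section BrownianExponential

variable {Ω : Type*} {mΩ : MeasurableSpace Ω} {P : Measure Ω} {F : Filtration ℝ≥0 mΩ}
  {z : ℝ≥0 → Ω → ℝ}

/-- The exponential `exp (a (z_u - z_s) + b (u - s))` of an increment of `z`. -/
noncomputable def expIncrement (z : ℝ≥0 → Ω → ℝ) (a b s u : ℝ) (ω : Ω) : ℝ :=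
  Real.exp (a * (z u.toNNReal ω - z s.toNNReal ω) + b * (u - s))

theorem expIncrement_pos (a b s u : ℝ) (ω : Ω) : 0 < expIncrement z a b s u ω := Real.exp_pos _

theorem expIncrement_trans (a b s u v : ℝ) (ω : Ω) :
    expIncrement z a b s u ω * expIncrement z a b u v ω = expIncrement z a b s v ω := by
  simp only [expIncrement, ← Real.exp_add]
  ring_nf

theorem expIncrement_mul (a b a' b' s u : ℝ) (ω : Ω) :
    expIncrement z a b s u ω * expIncrement z a' b' s u ω =
      expIncrement z (a + a') (b + b') s u ω := by
  simp only [expIncrement, ← Real.exp_add]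
  ring_nf

theorem expIncrement_pow (a b s u : ℝ) (n : ℕ) (ω : Ω) :
    expIncrement z a b s u ω ^ n = expIncrement z (n * a) (n * b) s u ω := by
  simp only [expIncrement, ← Real.exp_nat_mul]
  ring_nf

namespace IsFilteredBrownian

theorem measurable_expIncrement (hz : IsFilteredBrownian P F z) (a b : ℝ) {s u : ℝ}
    (hsu : s ≤ u) : Measurable[F u.toNNReal] (expIncrement z a b s u) := by
  have h1 : Measurable[F u.toNNReal] (z u.toNNReal) := hz.adapted _
  have h2 : Measurable[F u.toNNReal] (z s.toNNReal) :=
    (hz.adapted _).mono (F.mono (Real.toNNReal_le_toNNReal hsu)) le_rfl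
  exact Real.measurable_exp.comp (((h1.sub h2).const_mul a).add_const _)

theorem integral_expIncrement (hz : IsFilteredBrownian P F z) (a b : ℝ) {s u : ℝ}
    (hs : 0 ≤ s) (hsu : s ≤ u) :
    Integrable (expIncrement z a b s u) P ∧
      ∫ ω, expIncrement z a b s u ω ∂P = Real.exp ((a ^ 2 / 2 + b) * (u - s)) := by
  have hlaw := hz.isBrownian.hasLaw_sub u.toNNReal s.toNNReal
  have hv : ((nndist (u.toNNReal).1 (s.toNNReal).1 : ℝ≥0) : ℝ) = u - s := by
    rw [coe_nndist, Real.dist_eq]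
    change |((u.toNNReal : ℝ≥0) : ℝ) - ((s.toNNReal : ℝ≥0) : ℝ)| = u - s
    rw [Real.coe_toNNReal _ (hs.trans hsu), Real.coe_toNNReal _ hs, abs_of_nonneg (by linarith)]
  have heq : expIncrement z a b s u = fun ω ↦
      Real.exp (b * (u - s)) * Real.exp (a * (z u.toNNReal - z s.toNNReal) ω) := by
    ext ω
    rw [← Real.exp_add, expIncrement, add_comm]
    rfl
  have hint : Integrable (fun ω ↦ Real.exp (a * (z u.toNNReal - z s.toNNReal) ω)) P := by
    have := integrable_exp_mul_gaussianReal (μ := 0)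
      (v := nndist (u.toNNReal).1 (s.toNNReal).1) a
    rw [← hlaw.map_eq] at this
    exact this.comp_aemeasurable hlaw.aemeasurable
  refine ⟨by rw [heq]; exact hint.const_mul _, ?_⟩
  rw [heq, integral_const_mul]
  have hm := mgf_gaussianReal hlaw.map_eq a
  rw [mgf, hv] at hm
  rw [hm, ← Real.exp_add]
  ring_nf

/-- Factorisation of expectations over the past, an increment and an exponential of the future. -/
theorem integral_mul_increment_mul (hz : IsFilteredBrownian P F z) [IsProbabilityMeasure P]
    {a b s u v : ℝ} (hs : 0 ≤ s) (hsu : s ≤ u) (huv : u ≤ v) (hab : a ^ 2 / 2 + b = 0)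
    {Y : Ω → ℝ} (hYm : Measurable[F s.toNNReal] Y) (hY : Integrable Y P)
    {φ : ℝ → ℝ} (hφm : Measurable φ)
    (hφ : Integrable (fun ω ↦ φ (z u.toNNReal ω - z s.toNNReal ω)) P) :
    Integrable (fun ω ↦ Y ω * φ (z u.toNNReal ω - z s.toNNReal ω) * expIncrement z a b u v ω) P ∧
    ∫ ω, Y ω * φ (z u.toNNReal ω - z s.toNNReal ω) * expIncrement z a b u v ω ∂P =
      (∫ ω, Y ω ∂P) * ∫ ω, φ (z u.toNNReal ω - z s.toNNReal ω) ∂P := by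
  have hnn := Real.toNNReal_le_toNNReal hsu
  have hind1 : IndepFun Y (fun ω ↦ φ (z u.toNNReal ω - z s.toNNReal ω)) P := by
    have h := hz.indep_increments s.toNNReal u.toNNReal hnn
    rw [IndepFun_iff_Indep]
    refine indep_of_indep_of_le_left (indep_of_indep_of_le_right h ?_) hYm.comap_le
    exact (hφm.comp (comap_measurable _)).comap_le
  have hYφ := hind1.integrable_mul hY hφ
  have hYφm : Measurable[F u.toNNReal]
      (fun ω ↦ Y ω * φ (z u.toNNReal ω - z s.toNNReal ω)) := by
    have h1 : Measurable[F u.toNNReal] (z u.toNNReal) := hz.adapted _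
    have h2 : Measurable[F u.toNNReal] (z s.toNNReal) := (hz.adapted _).mono (F.mono hnn) le_rfl
    exact (hYm.mono (F.mono hnn) le_rfl).mul (hφm.comp (h1.sub h2))
  have hind2 : IndepFun (fun ω ↦ Y ω * φ (z u.toNNReal ω - z s.toNNReal ω))
      (expIncrement z a b u v) P := by
    have h := hz.indep_increments u.toNNReal v.toNNReal (Real.toNNReal_le_toNNReal huv)
    rw [IndepFun_iff_Indep]
    refine indep_of_indep_of_le_left (indep_of_indep_of_le_right h ?_) hYφm.comap_le
    have hψ : Measurable fun x ↦ Real.exp (a * x + b * (v - u)) := by fun_prop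
    exact (hψ.comp (comap_measurable _)).comap_le
  have hE := hz.integral_expIncrement a b (hs.trans hsu) huv
  refine ⟨hind2.integrable_mul hYφ hE.1, ?_⟩
  rw [hind2.integral_fun_mul_eq_mul_integral hYφ.aestronglyMeasurable hE.1.aestronglyMeasurable,
    hE.2, hab, zero_mul, Real.exp_zero, mul_one]
  exact hind1.integral_fun_mul_eq_mul_integral hY.aestronglyMeasurable hφ.aestronglyMeasurable

/-- The Girsanov density and the price started from `1`. -/
theorem integral_density_mul_price_pow (hz : IsFilteredBrownian P F z) (σ θ : ℝ) {s u : ℝ}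
    (hs : 0 ≤ s) (hsu : s ≤ u) (n : ℕ) :
    Integrable (fun ω ↦ expIncrement z (-θ) (-(θ ^ 2 / 2)) s u ω *
      expIncrement z σ (σ * θ - σ ^ 2 / 2) s u ω ^ n) P ∧
    ∫ ω, expIncrement z (-θ) (-(θ ^ 2 / 2)) s u ω *
      expIncrement z σ (σ * θ - σ ^ 2 / 2) s u ω ^ n ∂P =
      Real.exp (n * (n - 1) / 2 * (σ ^ 2 * (u - s))) := by
  simp_rw [expIncrement_pow, expIncrement_mul]
  refine ⟨(hz.integral_expIncrement _ _ hs hsu).1, ?_⟩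
  rw [(hz.integral_expIncrement _ _ hs hsu).2]
  -- All terms in `θ` cancel: `(nσ - θ)² / 2 - θ² / 2 + n (σθ - σ² / 2) = n (n - 1) σ² / 2`.
  ring_nf

end IsFilteredBrownian

/-- The fourth central moment, under the martingale measure, of the price started from `1`, as a
function of the integrated variance. -/
noncomputable def lognormalFourthMoment (x : ℝ) : ℝ :=
  Real.exp (6 * x) - 4 * Real.exp (3 * x) + 6 * Real.exp x - 3

/-- The function and its derivative vanish at `0`, so it is `o(x)`. A second moment would not do:
summed over the grid it tends to the quadratic variation. -/
theorem tendsto_mul_lognormalFourthMoment (c : ℝ) :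
    Filter.Tendsto (fun n : ℕ ↦ n * lognormalFourthMoment (c / n)) Filter.atTop (nhds 0) := by
  have hderiv : HasDerivAt lognormalFourthMoment 0 0 := by
    have h6 := ((hasDerivAt_id (0 : ℝ)).const_mul 6).exp
    have h3 := (((hasDerivAt_id (0 : ℝ)).const_mul 3).exp).const_mul 4
    have h1 := ((hasDerivAt_id (0 : ℝ)).exp).const_mul 6
    refine (((h6.sub h3).add h1).sub_const 3).congr_deriv ?_
    simp only [id_eq, mul_zero, Real.exp_zero]
    norm_num
  have hz : lognormalFourthMoment 0 = 0 := by simp [lognormalFourthMoment]; norm_num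
  have hlo := hderiv.isLittleO
  simp only [hz, sub_zero, smul_zero] at hlo
  have hc : Filter.Tendsto (fun n : ℕ ↦ c / (n : ℝ)) Filter.atTop (nhds 0) :=
    tendsto_const_div_atTop_nhds_zero_nat c
  have h := hlo.comp_tendsto hc
  have h2 := (Asymptotics.isBigO_refl (fun n : ℕ ↦ (n : ℝ)) Filter.atTop).mul_isLittleO h
  have h3 : (fun n : ℕ ↦ (n : ℝ) * ((fun x : ℝ ↦ x) ∘ fun n : ℕ ↦ c / (n : ℝ)) n)
      =O[Filter.atTop] fun _ ↦ (1 : ℝ) := by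
    refine Asymptotics.IsBigO.of_bound |c| (Filter.eventually_atTop.2 ⟨1, fun n hn ↦ ?_⟩)
    have : (n : ℝ) ≠ 0 := by positivity
    simp [mul_div_cancel₀ _ this]
  exact (Asymptotics.isLittleO_one_iff ℝ).1 (h2.trans_isBigO h3)

/-- Terms of the discounted gain have zero mean under the martingale measure. -/
theorem IsFilteredBrownian.integral_gain_eq_zero (hz : IsFilteredBrownian P F z)
    [IsProbabilityMeasure P] (σ θ S : ℝ) {t s u T : ℝ} (ht : 0 ≤ t) (hts : t ≤ s) (hsu : s ≤ u)
    (huT : u ≤ T) {H : Ω → ℝ} (hHm : Measurable[F s.toNNReal] H) {N : ℝ} (hN : ∀ ω, |H ω| ≤ N) :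
    Integrable (fun ω ↦ expIncrement z (-θ) (-(θ ^ 2 / 2)) t T ω *
      (H ω * (S * expIncrement z σ (σ * θ - σ ^ 2 / 2) t u ω -
        S * expIncrement z σ (σ * θ - σ ^ 2 / 2) t s ω))) P ∧
    ∫ ω, expIncrement z (-θ) (-(θ ^ 2 / 2)) t T ω *
      (H ω * (S * expIncrement z σ (σ * θ - σ ^ 2 / 2) t u ω -
        S * expIncrement z σ (σ * θ - σ ^ 2 / 2) t s ω)) ∂P = 0 := by
  -- The density over `[t, T]` is split at `s` and `u`: `Y` collects what is known at `s`, `φ` the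
  -- factor of the increment, and the density over `[u, T]` has mean one.
  set Y : Ω → ℝ := fun ω ↦ H ω * (S * (expIncrement z (-θ) (-(θ ^ 2 / 2)) t s ω *
    expIncrement z σ (σ * θ - σ ^ 2 / 2) t s ω ^ 1))
  set φ : ℝ → ℝ := fun x ↦ Real.exp (-θ * x + -(θ ^ 2 / 2) * (u - s)) *
    (Real.exp (σ * x + (σ * θ - σ ^ 2 / 2) * (u - s)) - 1)
  have hφeq : (fun ω ↦ φ (z u.toNNReal ω - z s.toNNReal ω)) = fun ω ↦
      expIncrement z (-θ) (-(θ ^ 2 / 2)) s u ω * expIncrement z σ (σ * θ - σ ^ 2 / 2) s u ω ^ 1 -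
      expIncrement z (-θ) (-(θ ^ 2 / 2)) s u ω * expIncrement z σ (σ * θ - σ ^ 2 / 2) s u ω ^ 0 := by
    ext ω
    simp only [φ, expIncrement]
    ring
  have hm := hz.integral_density_mul_price_pow σ θ (ht.trans hts) hsu
  have hYm : Measurable[F s.toNNReal] Y :=
    hHm.mul (((hz.measurable_expIncrement _ _ hts).mul
      ((hz.measurable_expIncrement _ _ hts).pow_const 1)).const_mul S)
  have hY : Integrable Y P := by
    refine (((hz.integral_density_mul_price_pow σ θ ht hts 1).1.const_mul S).bdd_mul
      (c := N) (hHm.mono (F.le _) le_rfl).aestronglyMeasurable (Filter.Eventually.of_forall ?_))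
    exact fun ω ↦ hN ω
  have key := hz.integral_mul_increment_mul (a := -θ) (b := -(θ ^ 2 / 2)) (ht.trans hts) hsu huT
    (by ring) hYm hY (φ := φ) (by fun_prop) (by rw [hφeq]; exact (hm 1).1.sub (hm 0).1)
  have heq : (fun ω ↦ expIncrement z (-θ) (-(θ ^ 2 / 2)) t T ω *
      (H ω * (S * expIncrement z σ (σ * θ - σ ^ 2 / 2) t u ω -
        S * expIncrement z σ (σ * θ - σ ^ 2 / 2) t s ω))) = fun ω ↦
      Y ω * φ (z u.toNNReal ω - z s.toNNReal ω) * expIncrement z (-θ) (-(θ ^ 2 / 2)) u T ω := by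
    ext ω
    have h := congrFun hφeq ω
    rw [h, ← expIncrement_trans (-θ) (-(θ ^ 2 / 2)) t u T, ← expIncrement_trans (-θ) _ t s u,
      ← expIncrement_trans σ _ t s u]
    simp only [Y]
    ring
  rw [heq]
  refine ⟨key.1, ?_⟩
  -- The moments of order `1` and `0` both equal one; this is the martingale property.
  rw [key.2, hφeq, integral_sub (hm 1).1 (hm 0).1, (hm 1).2, (hm 0).2]
  simp

/-- The increment is the price at `s` times (relative price − 1). Independence separates the two
fourth powers, and the second expands binomially. -/
theorem IsFilteredBrownian.integral_price_increment_pow_four (hz : IsFilteredBrownian P F z)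
    [IsProbabilityMeasure P] (σ θ S : ℝ) {t s u T : ℝ} (ht : 0 ≤ t) (hts : t ≤ s) (hsu : s ≤ u)
    (huT : u ≤ T) :
    Integrable (fun ω ↦ expIncrement z (-θ) (-(θ ^ 2 / 2)) t T ω *
      (S * expIncrement z σ (σ * θ - σ ^ 2 / 2) t u ω -
        S * expIncrement z σ (σ * θ - σ ^ 2 / 2) t s ω) ^ 4) P ∧
    ∫ ω, expIncrement z (-θ) (-(θ ^ 2 / 2)) t T ω *
      (S * expIncrement z σ (σ * θ - σ ^ 2 / 2) t u ω -
        S * expIncrement z σ (σ * θ - σ ^ 2 / 2) t s ω) ^ 4 ∂P =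
      S ^ 4 * Real.exp (6 * (σ ^ 2 * (s - t))) * lognormalFourthMoment (σ ^ 2 * (u - s)) := by
  set Y : Ω → ℝ := fun ω ↦ S ^ 4 * (expIncrement z (-θ) (-(θ ^ 2 / 2)) t s ω *
    expIncrement z σ (σ * θ - σ ^ 2 / 2) t s ω ^ 4)
  set φ : ℝ → ℝ := fun x ↦ Real.exp (-θ * x + -(θ ^ 2 / 2) * (u - s)) *
    (Real.exp (σ * x + (σ * θ - σ ^ 2 / 2) * (u - s)) - 1) ^ 4
  set D : ℕ → Ω → ℝ := fun n ω ↦ expIncrement z (-θ) (-(θ ^ 2 / 2)) s u ω *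
    expIncrement z σ (σ * θ - σ ^ 2 / 2) s u ω ^ n with hD
  have hφeq : (fun ω ↦ φ (z u.toNNReal ω - z s.toNNReal ω)) = fun ω ↦
      D 4 ω - 4 * D 3 ω + 6 * D 2 ω - 4 * D 1 ω + D 0 ω := by
    ext ω
    simp only [φ, D, expIncrement]
    ring
  have hm := hz.integral_density_mul_price_pow σ θ (ht.trans hts) hsu
  have hDi : ∀ n, Integrable (D n) P := fun n ↦ (hm n).1
  have hY0 := hz.integral_density_mul_price_pow σ θ ht hts 4
  have hYm : Measurable[F s.toNNReal] Y :=
    ((hz.measurable_expIncrement _ _ hts).mul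
      ((hz.measurable_expIncrement _ _ hts).pow_const 4)).const_mul _
  have hY : Integrable Y P := hY0.1.const_mul _
  have h1 := (hDi 4).sub ((hDi 3).const_mul 4)
  have h2 := h1.add ((hDi 2).const_mul 6)
  have h3 := h2.sub ((hDi 1).const_mul 4)
  have key := hz.integral_mul_increment_mul (a := -θ) (b := -(θ ^ 2 / 2)) (ht.trans hts) hsu huT
    (by ring) hYm hY (φ := φ) (by fun_prop) (by rw [hφeq]; exact h3.add (hDi 0))
  have heq : (fun ω ↦ expIncrement z (-θ) (-(θ ^ 2 / 2)) t T ω *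
      (S * expIncrement z σ (σ * θ - σ ^ 2 / 2) t u ω -
        S * expIncrement z σ (σ * θ - σ ^ 2 / 2) t s ω) ^ 4) = fun ω ↦
      Y ω * φ (z u.toNNReal ω - z s.toNNReal ω) * expIncrement z (-θ) (-(θ ^ 2 / 2)) u T ω := by
    ext ω
    have h := congrFun hφeq ω
    rw [h, ← expIncrement_trans (-θ) (-(θ ^ 2 / 2)) t u T, ← expIncrement_trans (-θ) _ t s u,
      ← expIncrement_trans σ _ t s u]
    simp only [Y, D]
    ring
  have hφint : ∫ ω, φ (z u.toNNReal ω - z s.toNNReal ω) ∂P =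
      lognormalFourthMoment (σ ^ 2 * (u - s)) := by
    rw [hφeq]
    have e1 := integral_add h3 (hDi 0)
    have e2 := integral_sub h2 ((hDi 1).const_mul 4)
    have e3 := integral_add h1 ((hDi 2).const_mul 6)
    have e4 := integral_sub (hDi 4) ((hDi 3).const_mul 4)
    simp only [Pi.add_apply, Pi.sub_apply, integral_const_mul] at e1 e2 e3 e4
    rw [e1, e2, e3, e4, (hm 4).2, (hm 3).2, (hm 2).2, (hm 1).2, (hm 0).2, lognormalFourthMoment]
    norm_num
    ring
  rw [heq]
  refine ⟨key.1, ?_⟩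
  rw [key.2, hφint]
  simp only [Y]
  rw [integral_const_mul, hY0.2]
  norm_num

end BrownianExponential

/-! ### Truncated gains and the zero-mean argument -/

/-- The gain from holding `q k` units of an asset of price `A` over the `k`-th period, where no
position is held in a period that starts with a loss above `a` or with `|q k| > N`. -/
noncomputable def truncatedGain (a N : ℝ) (q A : ℕ → ℝ) : ℕ → ℝ
  | 0 => 0
  | k + 1 => truncatedGain a N q A k +
      (if -a ≤ truncatedGain a N q A k ∧ |q k| ≤ N then q k else 0) * (A (k + 1) - A k)

theorem truncatedGain_eq_sum (a N : ℝ) (q A : ℕ → ℝ) (m : ℕ) :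
    truncatedGain a N q A m = ∑ k ∈ Finset.range m,
      (if -a ≤ truncatedGain a N q A k ∧ |q k| ≤ N then q k else 0) * (A (k + 1) - A k) := by
  induction m with
  | zero => rfl
  | succ m ih => rw [Finset.sum_range_succ, ← ih]; rfl

/-- Without losses above `a` or positions above `N` the truncation has no effect. -/
theorem truncatedGain_eq_gain {a N : ℝ} {q A : ℕ → ℝ} {n : ℕ} (hq : ∀ k < n, |q k| ≤ N)
    (hG : ∀ m < n, -a ≤ ∑ k ∈ Finset.range m, q k * (A (k + 1) - A k)) :
    ∀ m ≤ n, truncatedGain a N q A m = ∑ k ∈ Finset.range m, q k * (A (k + 1) - A k) := by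
  intro m
  induction m with
  | zero => intro _; rfl
  | succ m ih =>
    intro hm
    have ih := ih (by omega)
    rw [Finset.sum_range_succ, ← ih, truncatedGain, if_pos ⟨ih ▸ hG m (by omega), hq m (by omega)⟩]

/-- The loss exceeds `a` by at most one step, which is controlled by fourth powers. -/
theorem neg_le_truncatedGain {a N : ℝ} (ha : 0 ≤ a) (q A : ℕ → ℝ) (n : ℕ) :
    ∀ m ≤ n, -(a + 1 + N ^ 4 * ∑ k ∈ Finset.range n, (A (k + 1) - A k) ^ 4) ≤
      truncatedGain a N q A m := by
  have hsum : ∀ k < n, (A (k + 1) - A k) ^ 4 ≤ ∑ k ∈ Finset.range n, (A (k + 1) - A k) ^ 4 :=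
    fun k hk ↦ Finset.single_le_sum (f := fun k ↦ (A (k + 1) - A k) ^ 4)
      (fun i _ ↦ by positivity) (Finset.mem_range.2 hk)
  have hsum0 : 0 ≤ ∑ k ∈ Finset.range n, (A (k + 1) - A k) ^ 4 :=
    Finset.sum_nonneg fun i _ ↦ by positivity
  have hN4 : 0 ≤ N ^ 4 := by positivity
  intro m
  induction m with
  | zero =>
    intro _
    have := mul_nonneg hN4 hsum0
    simp only [truncatedGain]
    linarith
  | succ m ih =>
    intro hm
    have ih := ih (by omega)
    rw [truncatedGain]
    split_ifs with h
    · have h1 : |q m * (A (m + 1) - A m)| ≤ N * |A (m + 1) - A m| := by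
        rw [abs_mul]; exact mul_le_mul_of_nonneg_right h.2 (abs_nonneg _)
      -- The inequality `x ≤ 1 + x⁴` bounds one step by a constant plus a term whose sum has small
      -- mean.
      have h2 : N * |A (m + 1) - A m| ≤ 1 + N ^ 4 * (A (m + 1) - A m) ^ 4 := by
        have h3 : N ^ 4 * (A (m + 1) - A m) ^ 4 = (N * |A (m + 1) - A m|) ^ 4 := by
          rw [mul_pow, (by decide : Even 4).pow_abs]
        rw [h3]
        set x := N * |A (m + 1) - A m|
        nlinarith [sq_nonneg (x ^ 2 - 1), sq_nonneg (x - 1)]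
      have h4 := mul_le_mul_of_nonneg_left (hsum m (by omega)) hN4
      have h5 := (abs_le.1 h1).1
      linarith [h.1]
    · rw [zero_mul, add_zero]; exact ih

section

variable {Ω : Type*} {mΩ : MeasurableSpace Ω} {P : Measure Ω} {F : Filtration ℝ≥0 mΩ}
  {z : ℝ≥0 → Ω → ℝ}

/-- Truncated gains of adapted positions stay below a fixed level with a probability that is
bounded away from zero, uniformly in the positions. -/
theorem IsFilteredBrownian.le_measure_truncatedGain_lt (hz : IsFilteredBrownian P F z)
    [IsProbabilityMeasure P] (σ θ S : ℝ) {t T : ℝ} (ht : 0 ≤ t) (htT : t ≤ T) {a N : ℝ}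
    (ha : 0 ≤ a) (hN : 0 ≤ N) {n : ℕ} (hn : n ≠ 0)
    (hsmall : N ^ 4 * (S ^ 4 * Real.exp (6 * (σ ^ 2 * (T - t))) *
      (n * lognormalFourthMoment (σ ^ 2 * (T - t) / n))) ≤ 1)
    (q A : ℕ → Ω → ℝ)
    (hq : ∀ k < n, Measurable[F (t + k * ((T - t) / n)).toNNReal] (q k))
    (hA : ∀ k ω, A k ω = S * expIncrement z σ (σ * θ - σ ^ 2 / 2) t (t + k * ((T - t) / n)) ω) :
    1 / (4 * Real.exp (θ ^ 2 * (T - t))) ≤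
      P.real {ω | truncatedGain a N (q · ω) (A · ω) n < 2 * a + 4} := by
  set h := (T - t) / n with hh
  have hn0 : (0 : ℝ) < n := by positivity
  have hh0 : 0 ≤ h := div_nonneg (by linarith) hn0.le
  have hnh : n * h = T - t := by rw [hh]; field_simp
  set τ : ℕ → ℝ := fun k ↦ t + k * h
  have hτt : ∀ k, t ≤ τ k := fun k ↦ by simp only [τ]; have := mul_nonneg k.cast_nonneg hh0; linarith
  have hτs : ∀ k, τ (k + 1) = τ k + h := fun k ↦ by simp only [τ]; push_cast; ring
  have hττ : ∀ k, τ k ≤ τ (k + 1) := fun k ↦ by rw [hτs]; linarith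
  have hτT : ∀ k ≤ n, τ k ≤ T := fun k hk ↦ by
    have : (k : ℝ) ≤ n := by exact_mod_cast hk
    simp only [τ]; nlinarith
  set Λ : Ω → ℝ := expIncrement z (-θ) (-(θ ^ 2 / 2)) t T
  set G : ℕ → Ω → ℝ := fun m ω ↦ truncatedGain a N (q · ω) (A · ω) m
  have hAm : ∀ k, Measurable[F (τ k).toNNReal] (A k) := fun k ↦ by
    have : A k = fun ω ↦ S * expIncrement z σ (σ * θ - σ ^ 2 / 2) t (τ k) ω := funext (hA k)
    rw [this]
    exact (hz.measurable_expIncrement _ _ (hτt k)).const_mul S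
  have hFm : ∀ k, F (τ k).toNNReal ≤ F (τ (k + 1)).toNNReal := fun k ↦
    F.mono (Real.toNNReal_le_toNNReal (hττ k))
  set H : ℕ → Ω → ℝ := fun k ω ↦ if -a ≤ G k ω ∧ |q k ω| ≤ N then q k ω else 0
  have hHmeas : ∀ k < n, Measurable[F (τ k).toNNReal] (G k) →
      Measurable[F (τ k).toNNReal] (H k) := fun k hk hG ↦ by
    refine Measurable.ite ?_ (hq k hk) measurable_const
    have habs : Measurable[F (τ k).toNNReal] fun ω ↦ |q k ω| :=
      measurable_abs.comp (hq k hk)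
    exact (measurableSet_le measurable_const hG).inter (measurableSet_le habs measurable_const)
  have hGm : ∀ k ≤ n, Measurable[F (τ k).toNNReal] (G k) := by
    intro k
    induction k with
    | zero => intro _; exact measurable_const
    | succ k ih =>
      intro hk
      have ih := ih (by omega)
      exact (ih.mono (hFm k) le_rfl).add (((hHmeas k (by omega) ih).mono (hFm k) le_rfl).mul
        ((hAm (k + 1)).sub ((hAm k).mono (hFm k) le_rfl)))
  have hHN : ∀ k ω, |H k ω| ≤ N := fun k ω ↦ by
    simp only [H]
    split_ifs with h
    · exact h.2
    · simpa using hN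
  have hgain := fun k (hk : k < n) ↦ hz.integral_gain_eq_zero σ θ S ht (hτt k) (hττ k)
    (hτT (k + 1) hk) (hHmeas k hk (hGm k hk.le)) (hHN k)
  have hfour := fun k (hk : k < n) ↦ hz.integral_price_increment_pow_four σ θ S ht (hτt k) (hττ k)
    (hτT (k + 1) hk)
  have hGsum : ∀ ω, Λ ω * G n ω = ∑ k ∈ Finset.range n,
      Λ ω * (H k ω * (S * expIncrement z σ (σ * θ - σ ^ 2 / 2) t (τ (k + 1)) ω -
        S * expIncrement z σ (σ * θ - σ ^ 2 / 2) t (τ k) ω)) := fun ω ↦ by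
    simp only [G]
    rw [truncatedGain_eq_sum, Finset.mul_sum]
    refine Finset.sum_congr rfl fun k _ ↦ ?_
    rw [hA, hA]
  have hGint : Integrable (fun ω ↦ Λ ω * G n ω) P := by
    simp_rw [hGsum]
    exact integrable_finsetSum _ fun k hk ↦ (hgain k (Finset.mem_range.1 hk)).1
  have hG0 : ∫ ω, Λ ω * G n ω ∂P = 0 := by
    simp_rw [hGsum]
    rw [integral_finsetSum _ fun k hk ↦ (hgain k (Finset.mem_range.1 hk)).1]
    exact Finset.sum_eq_zero fun k hk ↦ (hgain k (Finset.mem_range.1 hk)).2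
  set Q : Ω → ℝ := fun ω ↦ ∑ k ∈ Finset.range n, (A (k + 1) ω - A k ω) ^ 4
  have hQsum : ∀ ω, Λ ω * Q ω = ∑ k ∈ Finset.range n,
      Λ ω * (S * expIncrement z σ (σ * θ - σ ^ 2 / 2) t (τ (k + 1)) ω -
        S * expIncrement z σ (σ * θ - σ ^ 2 / 2) t (τ k) ω) ^ 4 := fun ω ↦ by
    simp only [Q]
    rw [Finset.mul_sum]
    refine Finset.sum_congr rfl fun k _ ↦ ?_
    rw [hA, hA]
  have hQint : Integrable (fun ω ↦ Λ ω * Q ω) P := by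
    simp_rw [hQsum]
    exact integrable_finsetSum _ fun k hk ↦ (hfour k (Finset.mem_range.1 hk)).1
  -- It is the mean of a fourth power against a positive density; the sign is needed to enlarge the
  -- exponential factor in front of it.
  have hf0 : 0 ≤ lognormalFourthMoment (σ ^ 2 * h) := by
    have h1 : 0 ≤ ∫ ω, expIncrement z (-θ) (-(θ ^ 2 / 2)) t T ω *
        (1 * expIncrement z σ (σ * θ - σ ^ 2 / 2) t (τ 1) ω -
        1 * expIncrement z σ (σ * θ - σ ^ 2 / 2) t (τ 0) ω) ^ 4 ∂P :=
      integral_nonneg fun ω ↦ mul_nonneg (expIncrement_pos _ _ _ _ _).le (by positivity)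
    rw [(hz.integral_price_increment_pow_four σ θ 1 ht (hτt 0) (hττ 0) (hτT 1 (by omega))).2,
      hτs, add_sub_cancel_left (τ 0) h] at h1
    exact nonneg_of_mul_nonneg_right h1 (by positivity)
  have hQle : ∫ ω, Λ ω * Q ω ∂P ≤ S ^ 4 * Real.exp (6 * (σ ^ 2 * (T - t))) *
      (n * lognormalFourthMoment (σ ^ 2 * (T - t) / n)) := by
    simp_rw [hQsum]
    rw [integral_finsetSum _ fun k hk ↦ (hfour k (Finset.mem_range.1 hk)).1]
    calc _ ≤ ∑ k ∈ Finset.range n, S ^ 4 * Real.exp (6 * (σ ^ 2 * (T - t))) *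
          lognormalFourthMoment (σ ^ 2 * h) := by
          refine Finset.sum_le_sum fun k hk ↦ ?_
          have hk := Finset.mem_range.1 hk
          rw [(hfour k hk).2, hτs, add_sub_cancel_left (τ k) h]
          refine mul_le_mul_of_nonneg_right (mul_le_mul_of_nonneg_left
            (Real.exp_le_exp.2 ?_) (by positivity)) hf0
          have := hτT k hk.le
          gcongr
      _ = _ := by
          rw [Finset.sum_const, Finset.card_range, nsmul_eq_mul, hh, mul_div_assoc]; ring
  set B : Set Ω := {ω | G n ω < 2 * a + 4}
  have hB : MeasurableSet B :=
    measurableSet_lt ((hGm n le_rfl).mono (F.le _) le_rfl) measurable_const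
  set E := Real.exp (θ ^ 2 * (T - t))
  have hE : 0 < E := Real.exp_pos _
  have hΛ := hz.integral_expIncrement (-θ) (-(θ ^ 2 / 2)) ht htT
  have hΛ1 : ∫ ω, Λ ω ∂P = 1 := by
    rw [hΛ.2]; ring_nf; simp
  have hΛ2 : Integrable (fun ω ↦ Λ ω ^ 2) P ∧ ∫ ω, Λ ω ^ 2 ∂P = E := by
    simp only [Λ, expIncrement_pow]
    refine ⟨(hz.integral_expIncrement _ _ ht htT).1, ?_⟩
    rw [(hz.integral_expIncrement _ _ ht htT).2]
    simp only [E]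
    push_cast
    ring_nf
  -- Off `B` the gain is at least `2a + 4`, on `B` at least `-(a + 1 + N⁴ Q)`; the product of `Λ`
  -- and the indicator of `B` is split by AM–GM. On integration `Λ² / (4E)` gives `1/4` and the
  -- losses at most `a + 2 = (2a + 4) / 2`, which leaves `1/4 ≤ E * P(B)`.
  have hpt : ∀ ω, (2 * a + 4) * Λ ω - (2 * a + 4) * (Λ ω ^ 2 / (4 * E) + E * B.indicator 1 ω)
      - (a + 1) * Λ ω - N ^ 4 * (Λ ω * Q ω) ≤ Λ ω * G n ω := by
    intro ω
    have hpos : 0 < Λ ω := expIncrement_pos _ _ _ _ _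
    have hlow : -(a + 1 + N ^ 4 * Q ω) ≤ G n ω :=
      neg_le_truncatedGain ha (q · ω) (A · ω) n n le_rfl
    have hQ0 : 0 ≤ N ^ 4 * Q ω := mul_nonneg (by positivity)
      (Finset.sum_nonneg fun i _ ↦ by positivity)
    by_cases hω : ω ∈ B
    · rw [Set.indicator_of_mem hω]
      have hamgm : Λ ω ≤ Λ ω ^ 2 / (4 * E) + E * 1 := by
        have : Λ ω ^ 2 / (4 * E) + E * 1 - Λ ω = (Λ ω - 2 * E) ^ 2 / (4 * E) := by
          field_simp; ring
        have h2 : 0 ≤ (Λ ω - 2 * E) ^ 2 / (4 * E) := by positivity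
        linarith
      have h1 := mul_le_mul_of_nonneg_left hamgm (by linarith : 0 ≤ 2 * a + 4)
      have h2 := mul_le_mul_of_nonneg_left hlow hpos.le
      simp only [Pi.one_apply]
      nlinarith
    · rw [Set.indicator_of_notMem hω]
      have hge : 2 * a + 4 ≤ G n ω := not_lt.1 hω
      have h1 := mul_le_mul_of_nonneg_left hge hpos.le
      have h2 : 0 ≤ (2 * a + 4) * (Λ ω ^ 2 / (4 * E) + E * 0) := by positivity
      have h3 := mul_nonneg hpos.le hQ0
      nlinarith
  have hind : Integrable (B.indicator (1 : Ω → ℝ)) P := (integrable_const 1).indicator hB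
  have i1 : Integrable (fun ω ↦ (2 * a + 4) * Λ ω) P := hΛ.1.const_mul _
  have i2 : Integrable (fun ω ↦ (2 * a + 4) * (Λ ω ^ 2 / (4 * E) + E * B.indicator 1 ω)) P :=
    ((hΛ2.1.div_const _).add (hind.const_mul E)).const_mul _
  have i3 : Integrable (fun ω ↦ (a + 1) * Λ ω) P := hΛ.1.const_mul _
  have i4 : Integrable (fun ω ↦ N ^ 4 * (Λ ω * Q ω)) P := hQint.const_mul _
  have hfin := integral_mono (((i1.sub i2).sub i3).sub i4) hGint hpt
  have e1 := integral_sub ((i1.sub i2).sub i3) i4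
  have e2 := integral_sub (i1.sub i2) i3
  have e3 := integral_sub i1 i2
  have e4 := integral_add (hΛ2.1.div_const (4 * E)) (hind.const_mul E)
  simp only [Pi.sub_apply, integral_const_mul, integral_div] at e1 e2 e3 e4 hfin
  rw [e1, e2, e3, e4, hG0, hΛ1, hΛ2.2, integral_indicator_one hB] at hfin
  have hsm : N ^ 4 * ∫ ω, Λ ω * Q ω ∂P ≤ 1 :=
    (mul_le_mul_of_nonneg_left hQle (by positivity)).trans hsmall
  have hquarter : E / (4 * E) = 1 / 4 := by field_simp
  rw [hquarter] at hfin
  rw [div_le_iff₀ (by positivity)]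
  change 1 ≤ P.real B * (4 * E)
  have h1 : (2 * a + 4) * 1 ≤ (2 * a + 4) * (P.real B * (4 * E)) := by nlinarith
  exact le_of_mul_le_mul_left h1 (by linarith)

end

/-! ### Exhaustion by events and elementary bounds on wealth -/

/-- If almost every point lies in some member of an increasing sequence of measurable sets, the
complements become small. -/
theorem exists_measureReal_compl_lt {Ω : Type*} {mΩ : MeasurableSpace Ω} {P : Measure Ω}
    [IsFiniteMeasure P] {s : ℕ → Set Ω} (hs : Monotone s) (hm : ∀ n, MeasurableSet (s n))
    (hae : ∀ᵐ ω ∂P, ∃ n, ω ∈ s n) {δ : ℝ} (hδ : 0 < δ) : ∃ n, P.real (s n)ᶜ < δ := by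
  have hanti : Antitone fun n ↦ (s n)ᶜ := fun i j hij ↦ Set.compl_subset_compl.2 (hs hij)
  have htend := tendsto_measure_iInter_atTop (μ := P) (s := fun n ↦ (s n)ᶜ)
    (fun n ↦ (hm n).compl.nullMeasurableSet) hanti ⟨0, measure_ne_top _ _⟩
  have h0 : P (⋂ n, (s n)ᶜ) = 0 := by
    rw [ae_iff] at hae
    convert hae using 2
    ext ω
    simp
  rw [h0] at htend
  have hr := (ENNReal.tendsto_toReal ENNReal.zero_ne_top).comp htend
  exact (hr.eventually (gt_mem_nhds (by simpa using hδ))).exists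

namespace MarketParams

variable {p : MarketParams}

theorem cashValue_le (hlam : 0 ≤ p.lam) (hmu : 0 ≤ p.mu) {S : ℝ} (hS : 0 < S) (y : ℝ) :
    p.cashValue y S ≤ y * S := by
  unfold cashValue
  split_ifs with h
  · nlinarith [mul_nonneg hmu (mul_nonneg hS.le h)]
  · nlinarith [mul_nonneg hlam (mul_nonneg hS.le (by linarith : 0 ≤ -y))]

theorem cashValue_sub_one_le (hlam : 0 ≤ p.lam) (hmu' : p.mu < 1) {S : ℝ}
    (hS : 0 < S) (y : ℝ) : p.cashValue (y - 1) S ≤ p.cashValue y S := by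
  unfold cashValue
  have h1 : 0 < (1 - p.mu) * S := mul_pos (by linarith) hS
  have h2 : 0 < (1 + p.lam) * S := mul_pos (by linarith) hS
  split_ifs with h h' h' <;> nlinarith

theorem cashValue_le_sub_one_add (hlam : 0 ≤ p.lam) (hmu : 0 ≤ p.mu)
    {S : ℝ} (hS : 0 < S) (y : ℝ) :
    p.cashValue y S ≤ p.cashValue (y - 1) S + (1 + p.lam) * S := by
  unfold cashValue
  have h3 : (1 - p.mu) * S ≤ (1 + p.lam) * S := mul_le_mul_of_nonneg_right (by linarith) hS.le
  split_ifs with h h' h' <;> nlinarith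

/-- Solvency refers to `y - 1` shares, the worse position, and thus covers both scenarios. -/
theorem neg_lt_terminalWealth (hlam : 0 ≤ p.lam) (hmu' : p.mu < 1)
    (hK : 0 < p.K) (j : Scenario) {E X y S : ℝ} (hS : 0 < S) (h : p.Solvent E p.T X y S) :
    -E < p.terminalWealth j X y S := by
  have hc := cashValue_sub_one_le hlam hmu' hS y
  unfold Solvent at h
  rw [sub_self, mul_zero, Real.exp_zero, mul_one] at h
  cases j with
  | one => simp only [terminalWealth]; linarith
  | w => simp only [terminalWealth]; split_ifs <;> linarith

/-- Conversely, the missing share is worth at most `(1 + λ) S` and the exercise payment is `K`, so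
large terminal wealth at a bounded price forces a large liquidation value. -/
theorem terminalWealth_le (hlam : 0 ≤ p.lam) (hmu : 0 ≤ p.mu) (hK : 0 < p.K)
    (j : Scenario) {X y S : ℝ} (hS : 0 < S) :
    p.terminalWealth j X y S ≤ X + p.cashValue (y - 1) S + (1 + p.lam) * S + p.K := by
  have hc := cashValue_le_sub_one_add hlam hmu hS y
  have hS' : 0 < (1 + p.lam) * S := mul_pos (by linarith) hS
  cases j with
  | one => simp only [terminalWealth]; linarith
  | w => simp only [terminalWealth]; split_ifs <;> linarith

variable {Ω : Type*} {mΩ : MeasurableSpace Ω} {P : Measure Ω} {F : Filtration ℝ≥0 mΩ}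
  {z : ℝ≥0 → Ω → ℝ}

theorem stock_pos {S : ℝ} (hS : 0 < S) (t s : ℝ) (ω : Ω) : 0 < p.stock z t S s ω :=
  mul_pos hS (Real.exp_pos _)

theorem continuous_stock (t S : ℝ) {ω : Ω} (hω : Continuous (z · ω)) :
    Continuous fun s ↦ p.stock z t S s ω := by
  unfold stock
  have : Continuous fun s : ℝ ↦ z s.toNNReal ω := hω.comp continuous_real_toNNReal
  fun_prop

theorem measurable_stock (hz : IsFilteredBrownian P F z) {t s : ℝ} (S : ℝ) (hts : t ≤ s) :
    Measurable[F s.toNNReal] (p.stock z t S s) := by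
  have h : p.stock z t S s = fun ω ↦ S * expIncrement z p.σ (p.α - p.σ ^ 2 / 2) t s ω := by
    ext ω
    simp only [stock, expIncrement, add_comm]
  rw [h]
  exact (hz.measurable_expIncrement _ _ hts).const_mul S

/-- The stock price at time `s`, discounted to time `t`. -/
noncomputable def discountedStock (p : MarketParams) (z : ℝ≥0 → Ω → ℝ) (t S s : ℝ) (ω : Ω) : ℝ :=
  Real.exp (-(p.r * (s - t))) * p.stock z t S s ω

/-- With the market price of risk `θ = (α - r) / σ`, the discounted price has the form that is a
martingale under the density with parameter `θ`. -/
theorem discountedStock_eq (hσ : 0 < p.σ) (t S s : ℝ) (ω : Ω) :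
    p.discountedStock z t S s ω = S * expIncrement z p.σ
      (p.σ * ((p.α - p.r) / p.σ) - p.σ ^ 2 / 2) t s ω := by
  rw [mul_div_cancel₀ _ hσ.ne']
  unfold discountedStock stock expIncrement
  rw [mul_left_comm, ← Real.exp_add]
  ring_nf

/-! ### Comparison of a strategy with its frictionless grid portfolio -/

namespace Strategy

variable {t X y S : ℝ} (π : p.Strategy P F z t X y S)

theorem L_nonneg (ω : Ω) (s : ℝ) : 0 ≤ π.L ω s := by
  rw [← π.L_before ω (min s (t - 1)) (by have := min_le_right s (t - 1); linarith)]
  exact (π.L ω).mono (min_le_left _ _)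

theorem M_nonneg (ω : Ω) (s : ℝ) : 0 ≤ π.M ω s := by
  rw [← π.M_before ω (min s (t - 1)) (by have := min_le_right s (t - 1); linarith)]
  exact (π.M ω).mono (min_le_left _ _)

theorem measurable_shares {s : ℝ} (hs : s ∈ Set.Icc t p.T) :
    Measurable[F s.toNNReal] (π.shares s) := by
  have : π.shares s = fun ω ↦ y + π.L ω s - π.M ω s := funext fun ω ↦ π.shares_eq ω s hs
  rw [this]
  exact ((π.L_adapted s hs).const_add y).sub (π.M_adapted s hs)

/-- The gain of the frictionless portfolio that holds one share less than the strategy and is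
rebalanced only at the times `t + k (T - t) / n`. -/
noncomputable def gridGain (n m : ℕ) (ω : Ω) : ℝ :=
  ∑ k ∈ Finset.range m, (π.shares (t + k * ((p.T - t) / n)) ω - 1) *
    (p.discountedStock z t S (t + (k + 1 : ℕ) * ((p.T - t) / n)) ω -
      p.discountedStock z t S (t + k * ((p.T - t) / n)) ω)

/-- The discounted liquidation value of the strategy, short of one share, at time `s`. -/
noncomputable def discountedWealth (s : ℝ) (ω : Ω) : ℝ :=
  Real.exp (-(p.r * (s - t))) *
    (π.bank s ω + p.cashValue (π.shares s ω - 1) (p.stock z t S s ω))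

theorem grid_mem {T : ℝ} (htT : t ≤ T) {n m : ℕ} (hn : n ≠ 0) (hm : m ≤ n) :
    t + m * ((T - t) / n) ∈ Set.Icc t T := by
  have hn0 : (0 : ℝ) < n := by positivity
  have hh0 : 0 ≤ (T - t) / n := div_nonneg (by linarith) hn0.le
  have hnh : n * ((T - t) / n) = T - t := by field_simp
  have hmn : (m : ℝ) ≤ n := by exact_mod_cast hm
  constructor
  · have := mul_nonneg (m.cast_nonneg (α := ℝ)) hh0
    linarith
  · have := mul_le_mul_of_nonneg_right hmn hh0
    linarith

/-- Proportional costs only reduce wealth, and the frictionless wealth is approximated by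
portfolios rebalanced on a fine grid. -/
theorem discountedWealth_le_of_osc (htT : t ≤ p.T) (hlam : 0 ≤ p.lam) (hmu : 0 ≤ p.mu)
    (hS : 0 < S) {ω : Ω} (hω : Continuous (z · ω))
    (hbank : ∀ s ∈ Set.Icc t p.T,
      π.bank s ω = X + (∫ u in t..s, p.r * π.bank u ω)
        - (1 + p.lam) * (∫ u in Set.Icc t s, p.stock z t S u ω ∂(π.L ω).measure)
        + (1 - p.mu) * (∫ u in Set.Icc t s, p.stock z t S u ω ∂(π.M ω).measure))
    {n : ℕ} (hn : n ≠ 0) {κ : ℝ} (hκ : 0 ≤ κ)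
    (hosc : ∀ u ∈ Set.Icc t p.T, ∀ v ∈ Set.Icc t p.T, |u - v| ≤ (p.T - t) / n →
      |p.discountedStock z t S u ω - p.discountedStock z t S v ω| ≤ κ) {m : ℕ} (hm : m ≤ n) :
    π.discountedWealth (t + m * ((p.T - t) / n)) ω ≤
      X + (y - 1) * S + π.gridGain n m ω + κ * (π.L ω p.T + π.M ω p.T) := by
  set h := (p.T - t) / n with hh
  have hn0 : (0 : ℝ) < n := by positivity
  have hh0 : 0 ≤ h := div_nonneg (by linarith) hn0.le
  have hnT : t + n * h = p.T := by rw [hh]; field_simp; ring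
  set A : ℝ → ℝ := fun s ↦ p.discountedStock z t S s ω with hAdef
  have hA : Continuous A := by
    have := p.continuous_stock t S hω
    simp only [hAdef, discountedStock]
    fun_prop
  have hA0 : ∀ s, 0 < A s := fun s ↦ mul_pos (Real.exp_pos _) (stock_pos hS t s ω)
  set s := t + m * h
  have hs : s ∈ Set.Icc t p.T := grid_mem htT hn hm
  have hb := discounted_bank_eq htT (p.continuous_stock t S hω) (π.L ω).measure (π.M ω).measure
    hbank s hs
  change _ = X - (1 + p.lam) * (∫ u in Set.Icc t s, A u ∂(π.L ω).measure)
    + (1 - p.mu) * (∫ u in Set.Icc t s, A u ∂(π.M ω).measure) at hb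
  have hL := abs_gain_sub_riemann_le hh0 hA (π.L ω) (π.L_before ω) n (ω := κ)
    (by rw [hnT]; exact hosc) m hm
  have hM := abs_gain_sub_riemann_le hh0 hA (π.M ω) (π.M_before ω) n (ω := κ)
    (by rw [hnT]; exact hosc) m hm
  have hLT : κ * π.L ω s ≤ κ * π.L ω p.T := mul_le_mul_of_nonneg_left ((π.L ω).mono hs.2) hκ
  have hMT : κ * π.M ω s ≤ κ * π.M ω p.T := mul_le_mul_of_nonneg_left ((π.M ω).mono hs.2) hκ
  -- Transaction costs enter only through these two nonnegative terms, which are dropped.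
  have hIL : 0 ≤ p.lam * ∫ u in Set.Icc t s, A u ∂(π.L ω).measure :=
    mul_nonneg hlam (integral_nonneg fun u ↦ (hA0 u).le)
  have hIM : 0 ≤ p.mu * ∫ u in Set.Icc t s, A u ∂(π.M ω).measure :=
    mul_nonneg hmu (integral_nonneg fun u ↦ (hA0 u).le)
  have hAt : A t = S := by simp [hAdef, discountedStock, stock]
  have hgrid : π.gridGain n m ω = (y - 1) * (A s - S)
      + ∑ k ∈ Finset.range m, π.L ω (t + k * h) * (A (t + (k + 1 : ℕ) * h) - A (t + k * h))
      - ∑ k ∈ Finset.range m, π.M ω (t + k * h) * (A (t + (k + 1 : ℕ) * h) - A (t + k * h)) := by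
    have htel : A s - S = ∑ k ∈ Finset.range m, (A (t + (k + 1 : ℕ) * h) - A (t + k * h)) := by
      rw [Finset.sum_range_sub (fun k : ℕ ↦ A (t + k * h)) m]
      simp [hAt, s]
    rw [htel, Finset.mul_sum, ← Finset.sum_add_distrib, ← Finset.sum_sub_distrib, gridGain]
    refine Finset.sum_congr rfl fun k hk ↦ ?_
    rw [π.shares_eq ω _ (grid_mem htT hn ((Finset.mem_range.1 hk).le.trans hm))]
    simp only [hAdef, h]
    ring
  have hcash : Real.exp (-(p.r * (s - t))) *
      p.cashValue (π.shares s ω - 1) (p.stock z t S s ω) ≤ (y + π.L ω s - π.M ω s - 1) * A s := by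
    have := mul_le_mul_of_nonneg_left
      (cashValue_le hlam hmu (p.stock_pos (z := z) hS t s ω) (π.shares s ω - 1))
      (Real.exp_pos (-(p.r * (s - t)))).le
    rw [← π.shares_eq ω s hs]
    refine this.trans (le_of_eq ?_)
    simp only [hAdef, discountedStock]
    ring
  have h1 := (abs_le.1 hL).2
  have h2 := (abs_le.1 hM).1
  rw [discountedWealth, mul_add, hb, hgrid]
  linarith

/-- Almost every price path is uniformly continuous on `[t, T]` and its total trading volume `V` is
finite, so an oscillation of `1 / (V + 1)` per period costs at most `1`. The required mesh depends
on the path. -/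
theorem eventually_discountedWealth_le (hz : IsFilteredBrownian P F z) (htT : t ≤ p.T)
    (hlam : 0 ≤ p.lam) (hmu : 0 ≤ p.mu) (hS : 0 < S) :
    ∀ᵐ ω ∂P, ∀ᶠ n : ℕ in Filter.atTop, ∀ m ≤ n,
      π.discountedWealth (t + m * ((p.T - t) / n)) ω ≤ X + (y - 1) * S + π.gridGain n m ω + 1 := by
  filter_upwards [hz.isBrownian.cont, π.bank_eq] with ω hω hbank
  have hA : Continuous fun s ↦ p.discountedStock z t S s ω := by
    have := p.continuous_stock t S hω
    simp only [discountedStock]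
    fun_prop
  set V := π.L ω p.T + π.M ω p.T
  have hV : 0 ≤ V := add_nonneg (π.L_nonneg ω _) (π.M_nonneg ω _)
  have huc := (isCompact_Icc (a := t) (b := p.T)).uniformContinuousOn_of_continuous
    hA.continuousOn
  obtain ⟨ε, hε, hosc⟩ := Metric.uniformContinuousOn_iff.1 huc (1 / (V + 1)) (by positivity)
  have hmesh : Filter.Tendsto (fun n : ℕ ↦ (p.T - t) / (n : ℝ)) Filter.atTop (nhds 0) :=
    tendsto_const_div_atTop_nhds_zero_nat _
  filter_upwards [hmesh.eventually (gt_mem_nhds hε), Filter.eventually_ne_atTop 0] with n hn hn0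
  intro m hm
  have h := π.discountedWealth_le_of_osc htT hlam hmu hS hω hbank hn0
    (κ := 1 / (V + 1)) (by positivity) (fun u hu v hv huv ↦
      (hosc u hu v hv (lt_of_le_of_lt huv hn)).le) hm
  have : 1 / (V + 1) * V ≤ 1 := by
    rw [one_div_mul_eq_div, div_le_one (by positivity)]; linarith
  linarith

theorem measurable_discountedWealth (hz : IsFilteredBrownian P F z) {s : ℝ}
    (hs : s ∈ Set.Icc t p.T) : Measurable (π.discountedWealth s) := by
  have h1 : Measurable (π.bank s) := (π.bank_adapted s hs).mono (F.le _) le_rfl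
  have h2 : Measurable (π.shares s) := (π.measurable_shares hs).mono (F.le _) le_rfl
  have h3 : Measurable (p.stock z t S s) := (measurable_stock hz S hs.1).mono (F.le _) le_rfl
  unfold discountedWealth cashValue
  refine (h1.add (Measurable.ite (measurableSet_le measurable_const (h2.sub_const 1)) ?_ ?_)
    ).const_mul _ <;> fun_prop

theorem measurable_gridGain (hz : IsFilteredBrownian P F z) (htT : t ≤ p.T) {n m : ℕ}
    (hn : n ≠ 0) (hm : m ≤ n) : Measurable (π.gridGain n m) := by
  have hA : ∀ k ≤ n, Measurable (p.discountedStock z t S (t + k * ((p.T - t) / n))) := fun k hk ↦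
    ((measurable_stock hz S (grid_mem htT hn hk).1).mono (F.le _) le_rfl).const_mul _
  unfold gridGain
  refine Finset.measurable_fun_sum _ fun k hk ↦ ?_
  have hk := Finset.mem_range.1 hk
  exact (((π.measurable_shares (grid_mem htT hn (by omega))).mono (F.le _) le_rfl).sub_const
    1).mul ((hA (k + 1) (by omega)).sub (hA k (by omega)))

end Strategy

/-! ### Bounds on expected utility and on the value function -/

theorem one_sub_exp_le_outcome (hlam : 0 ≤ p.lam) (hmu' : p.mu < 1) (hγ : 0 < p.γ)
    (hK : 0 < p.K) (j : Scenario) {E t X y S : ℝ} (htT : t ≤ p.T) (hS : 0 < S)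
    (π : p.Strategy P F z t X y S) (ω : Ω) : 1 - Real.exp (p.γ * E) ≤ p.outcome j E π ω := by
  unfold outcome
  split_ifs with h
  · have hw := neg_lt_terminalWealth hlam hmu' hK j (stock_pos hS t p.T ω)
      (h p.T ⟨htT, le_rfl⟩)
    unfold utility
    have : Real.exp (-(p.γ * p.terminalWealth j (π.bank p.T ω) (π.shares p.T ω)
        (p.stock z t S p.T ω))) ≤ Real.exp (p.γ * E) := by
      rw [Real.exp_le_exp]; nlinarith
    linarith
  · exact le_rfl

theorem outcome_le_one (j : Scenario) {E t X y S : ℝ} (π : p.Strategy P F z t X y S) (ω : Ω) :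
    p.outcome j E π ω ≤ 1 := by
  unfold outcome utility
  split_ifs
  · linarith [Real.exp_pos (-(p.γ * p.terminalWealth j (π.bank p.T ω) (π.shares p.T ω)
        (p.stock z t S p.T ω)))]
  · linarith [Real.exp_pos (p.γ * E)]

/-- Expected utility is bounded away from `1`, uniformly in the strategy. -/
theorem exists_integral_outcome_le [IsProbabilityMeasure P] (hz : IsFilteredBrownian P F z)
    (hσ : 0 < p.σ) (hlam : 0 ≤ p.lam) (hmu : 0 ≤ p.mu)
    (hγ : 0 < p.γ) (hK : 0 < p.K) (j : Scenario) {E t : ℝ} (hE : 0 < E) (ht : 0 ≤ t)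
    (htT : t ≤ p.T) (X y : ℝ) {S : ℝ} (hS : 0 < S) :
    ∃ ε > 0, ∀ π : p.Strategy P F z t X y S, ∫ ω, p.outcome j E π ω ∂P ≤ 1 - ε := by
  set θ := (p.α - p.r) / p.σ
  set Z := X + (y - 1) * S
  set D := Real.exp (-(p.r * (p.T - t)))
  have hD : 0 < D := Real.exp_pos _
  -- Solvency keeps discounted wealth above `-E * D`; subtracting `Z` and the grid error `1` bounds
  -- the grid gain below by `-a`.
  set a := E * D + |Z| + 1
  have ha : 0 ≤ a := by positivity
  set δ := 1 / (4 * Real.exp (θ ^ 2 * (p.T - t)))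
  have hδ : 0 < δ := by positivity
  -- `R` is fixed before the strategy, since `ε` depends on it through `w`.
  obtain ⟨R, hR⟩ := exists_measureReal_compl_lt (P := P)
    (s := fun R : ℕ ↦ {ω | p.stock z t S p.T ω ≤ R})
    (fun i j hij ω (hω : _ ≤ (i : ℝ)) ↦ hω.trans (Nat.cast_le.2 hij))
    (fun R ↦ measurableSet_le ((measurable_stock hz S htT).mono (F.le _) le_rfl) measurable_const)
    (Filter.Eventually.of_forall fun ω ↦ exists_nat_ge (p.stock z t S p.T ω))
    (by positivity : 0 < δ / 4)
  -- Chosen so that terminal wealth above `w` at a price at most `R` forces a final grid gain above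
  -- `2a + 4`.
  set w := (2 * a + 5 + |Z|) / D + (1 + p.lam) * R + p.K
  have hw : 0 ≤ w := by positivity
  set η := Real.exp (-(p.γ * w))
  have hη : 0 < η := Real.exp_pos _
  have hη1 : η ≤ 1 := Real.exp_le_one_iff.2 (by have := mul_nonneg hγ.le hw; linarith)
  -- The cap `1` handles a nonintegrable outcome, whose integral is `0` by default.
  refine ⟨min (η * (δ / 4)) 1, by positivity, fun π ↦ ?_⟩
  by_cases hint : Integrable (p.outcome j E π) P
  swap
  · rw [integral_undef hint]; linarith [min_le_right (η * (δ / 4)) 1]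
  by_contra! hcon
  have hcon : 1 - η * (δ / 4) < ∫ ω, p.outcome j E π ω ∂P := by
    linarith [min_le_left (η * (δ / 4)) 1]
  set bad : Set Ω := {ω | η ≤ 1 - p.outcome j E π ω}
  have hbad : P.real bad < δ / 4 := by
    -- Markov's inequality for the utility shortfall.
    have hmk := mul_meas_ge_le_integral_of_nonneg (μ := P) (f := fun ω ↦ 1 - p.outcome j E π ω)
      (Filter.Eventually.of_forall fun ω ↦ sub_nonneg.2 (outcome_le_one j π ω))
      ((integrable_const 1).sub hint) η
    rw [integral_sub (integrable_const 1) hint] at hmk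
    simp only [integral_const, probReal_univ, smul_eq_mul, mul_one] at hmk
    have : η * P.real bad < η * (δ / 4) := by
      change η * P.real bad ≤ _ at hmk
      linarith
    exact lt_of_mul_lt_mul_left this hη.le
  have hTmem : p.T ∈ Set.Icc t p.T := ⟨htT, le_rfl⟩
  obtain ⟨V, hV⟩ := exists_measureReal_compl_lt (P := P)
    (s := fun V : ℕ ↦ {ω | π.L ω p.T + π.M ω p.T ≤ V})
    (fun i j hij ω (hω : _ ≤ (i : ℝ)) ↦ hω.trans (Nat.cast_le.2 hij))
    (fun V ↦ measurableSet_le (((π.L_adapted p.T hTmem).add (π.M_adapted p.T hTmem)).mono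
      (F.le _) le_rfl) measurable_const)
    (Filter.Eventually.of_forall fun ω ↦ exists_nat_ge (π.L ω p.T + π.M ω p.T))
    (by positivity : 0 < δ / 4)
  -- Intersecting over all `n ≥ n₀` makes the events increase with `n₀`, which turns the pathwise
  -- mesh into one that works up to probability `δ / 4`.
  obtain ⟨n₀, hn₀⟩ := exists_measureReal_compl_lt (P := P)
    (s := fun n₀ : ℕ ↦ ⋂ n ≥ n₀, ⋂ m ≤ n, ⋂ (_ : n ≠ 0),
      {ω | π.discountedWealth (t + m * ((p.T - t) / n)) ω ≤ Z + π.gridGain n m ω + 1})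
    (fun i j hij ↦ Set.biInter_subset_biInter_left fun n hn ↦ le_trans hij hn)
    (fun n₀ ↦ MeasurableSet.iInter fun n ↦ MeasurableSet.iInter fun _ ↦ MeasurableSet.iInter
      fun m ↦ MeasurableSet.iInter fun hm ↦ MeasurableSet.iInter fun hn ↦ measurableSet_le
        (π.measurable_discountedWealth hz (Strategy.grid_mem htT hn hm))
        (((π.measurable_gridGain hz htT hn hm).const_add Z).add_const 1))
    (by
      filter_upwards [π.eventually_discountedWealth_le hz htT hlam hmu hS] with ω hω
      obtain ⟨n₀, h⟩ := Filter.eventually_atTop.1 hω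
      refine ⟨n₀, ?_⟩
      simp only [Set.mem_iInter]
      exact fun n hn m hm _ ↦ h n hn m hm) (by positivity : 0 < δ / 4)
  set N : ℝ := |y - 1| + V
  have hN : 0 ≤ N := by positivity
  obtain ⟨n, hnn₀, hn, hsmall⟩ : ∃ n : ℕ, n₀ ≤ n ∧ n ≠ 0 ∧
      N ^ 4 * (S ^ 4 * Real.exp (6 * (p.σ ^ 2 * (p.T - t))) *
      (n * lognormalFourthMoment (p.σ ^ 2 * (p.T - t) / n))) ≤ 1 := by
    have hlim := ((tendsto_mul_lognormalFourthMoment (p.σ ^ 2 * (p.T - t))).const_mul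
      (S ^ 4 * Real.exp (6 * (p.σ ^ 2 * (p.T - t))))).const_mul (N ^ 4)
    rw [mul_zero, mul_zero] at hlim
    obtain ⟨n, h1, h2, h3⟩ := ((Filter.eventually_ge_atTop n₀).and
      ((Filter.eventually_ne_atTop 0).and (hlim.eventually (gt_mem_nhds one_pos)))).exists
    exact ⟨n, h1, h2, h3.le⟩
  set q : ℕ → Ω → ℝ := fun k ω ↦ π.shares (t + k * ((p.T - t) / n)) ω - 1
  set A : ℕ → Ω → ℝ := fun k ↦ p.discountedStock z t S (t + k * ((p.T - t) / n))
  have hlow := hz.le_measure_truncatedGain_lt p.σ θ S ht htT ha hN hn hsmall q A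
    (fun k hk ↦ (π.measurable_shares (Strategy.grid_mem htT hn hk.le)).sub_const 1)
    (fun k ω ↦ discountedStock_eq hσ t S _ ω)
  -- Outside four events of probability below `δ / 4` each, the truncation is inactive and the gain
  -- is large, whereas a gain below `2a + 4` has probability at least `δ`.
  have hsub : {ω | truncatedGain a N (q · ω) (A · ω) n < 2 * a + 4} ⊆
      (bad ∪ {ω | p.stock z t S p.T ω ≤ R}ᶜ) ∪ ({ω | π.L ω p.T + π.M ω p.T ≤ V}ᶜ ∪
        (⋂ n ≥ n₀, ⋂ m ≤ n, ⋂ (_ : n ≠ 0), {ω | π.discountedWealth (t + m * ((p.T - t) / n)) ω ≤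
          Z + π.gridGain n m ω + 1})ᶜ) := by
    intro ω hω
    by_contra hnot
    simp only [Set.mem_union, Set.mem_compl_iff, not_or, not_not, Set.mem_iInter] at hnot
    obtain ⟨⟨hgood, hRω⟩, hVω, happrox⟩ := hnot
    have happrox : ∀ m ≤ n, π.discountedWealth (t + m * ((p.T - t) / n)) ω ≤
        Z + π.gridGain n m ω + 1 := fun m hm ↦ happrox n hnn₀ m hm hn
    have hRω : p.stock z t S p.T ω ≤ R := hRω
    have hVω : π.L ω p.T + π.M ω p.T ≤ V := hVω
    have hgood : 1 - p.outcome j E π ω < η := not_le.1 hgood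
    unfold outcome at hgood
    split_ifs at hgood with hsolv
    swap
    · have : 1 < Real.exp (p.γ * E) := Real.one_lt_exp_iff.2 (mul_pos hγ hE)
      linarith
    have hwealth : w < p.terminalWealth j (π.bank p.T ω) (π.shares p.T ω)
        (p.stock z t S p.T ω) := by
      unfold utility at hgood
      rw [sub_sub_cancel, Real.exp_lt_exp, neg_lt_neg_iff] at hgood
      exact lt_of_mul_lt_mul_left hgood hγ.le
    have hq : ∀ k < n, |q k ω| ≤ N := fun k hk ↦ by
      have hmem := Strategy.grid_mem htT hn hk.le
      have h1 := (π.L ω).mono hmem.2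
      have h2 := (π.M ω).mono hmem.2
      have h3 := π.L_nonneg ω (t + k * ((p.T - t) / n))
      have h4 := π.M_nonneg ω (t + k * ((p.T - t) / n))
      have h5 := le_abs_self (y - 1)
      have h6 := neg_abs_le (y - 1)
      simp only [q]
      rw [π.shares_eq ω _ hmem, abs_le]
      constructor <;> simp only [N] <;> linarith
    have hZ := le_abs_self Z
    have hloss : ∀ m < n, -a ≤ ∑ k ∈ Finset.range m, q k ω * (A (k + 1) ω - A k ω) := by
      intro m hm
      have hs := hsolv _ (Strategy.grid_mem htT hn hm.le)
      have hap := happrox m hm.le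
      unfold Solvent at hs
      have h1 := mul_lt_mul_of_pos_right hs hD
      rw [mul_assoc, ← Real.exp_add, mul_comm (π.bank _ ω + _)] at h1
      have h2 : p.r * (p.T - (t + m * ((p.T - t) / n))) + -(p.r * (p.T - t)) =
          -(p.r * (t + m * ((p.T - t) / n) - t)) := by ring
      rw [h2] at h1
      change -E * D < π.discountedWealth (t + m * ((p.T - t) / n)) ω at h1
      change -a ≤ π.gridGain n m ω
      simp only [a]
      linarith
    have hgain := truncatedGain_eq_gain (q := (q · ω)) (A := (A · ω)) hq hloss n le_rfl
    have hend := happrox n le_rfl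
    have hnT : t + n * ((p.T - t) / n) = p.T := by field_simp; ring
    rw [hnT] at hend
    have hup := terminalWealth_le hlam hmu hK j (X := π.bank p.T ω) (y := π.shares p.T ω)
      (stock_pos (p := p) (z := z) hS t p.T ω)
    have hlamR : (1 + p.lam) * p.stock z t S p.T ω ≤ (1 + p.lam) * R :=
      mul_le_mul_of_nonneg_left hRω (by linarith)
    have hliq : (2 * a + 5 + |Z|) / D <
        π.bank p.T ω + p.cashValue (π.shares p.T ω - 1) (p.stock z t S p.T ω) := by
      simp only [w] at hwealth
      linarith
    rw [div_lt_iff₀' hD] at hliq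
    change _ < π.discountedWealth p.T ω at hliq
    have hω : truncatedGain a N (q · ω) (A · ω) n < 2 * a + 4 := hω
    rw [hgain] at hω
    change π.gridGain n n ω < _ at hω
    linarith
  have htotal := (measureReal_mono (μ := P) hsub).trans ((measureReal_union_le _ _).trans
    (add_le_add (measureReal_union_le _ _) (measureReal_union_le _ _)))
  linarith

/-- The value function with bankruptcy state is at least the bankruptcy utility. -/
theorem one_sub_exp_le_valueB [IsProbabilityMeasure P] (hlam : 0 ≤ p.lam)
    (hmu' : p.mu < 1) (hγ : 0 < p.γ) (hK : 0 < p.K) (j : Scenario) {E t : ℝ} (hE : 0 < E)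
    (htT : t ≤ p.T) (X y : ℝ) {S : ℝ} (hS : 0 < S) :
    1 - Real.exp (p.γ * E) ≤ p.valueB P F z j E t X y S := by
  -- Covers the default value `0` of a nonintegrable outcome and of a supremum over no strategies.
  have hneg : 1 - Real.exp (p.γ * E) ≤ 0 := by
    linarith [Real.one_lt_exp_iff.2 (mul_pos hγ hE)]
  have hbound : ∀ π : p.Strategy P F z t X y S, 1 - Real.exp (p.γ * E) ≤
      ∫ ω, p.outcome j E π ω ∂P := fun π ↦ by
    by_cases hint : Integrable (p.outcome j E π) P
    · have := integral_mono (integrable_const (1 - Real.exp (p.γ * E))) hint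
        (one_sub_exp_le_outcome hlam hmu' hγ hK j htT hS π)
      simpa using this
    · rwa [integral_undef hint]
  unfold valueB
  split_ifs
  · rcases isEmpty_or_nonempty (p.Strategy P F z t X y S) with h | ⟨⟨π⟩⟩
    · rwa [Real.iSup_of_isEmpty]
    · refine (hbound π).trans
        (le_ciSup (f := fun π : p.Strategy P F z t X y S ↦ ∫ ω, p.outcome j E π ω ∂P) ⟨1, ?_⟩ π)
      rintro _ ⟨π', rfl⟩
      by_cases hint : Integrable (p.outcome j E π') P
      · have := integral_mono hint (integrable_const 1) (outcome_le_one j π')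
        simpa using this
      · simp only [integral_undef hint, zero_le_one]
  · exact le_rfl

/-- The gap `ε` is common to all strategies, so strictness survives the supremum. -/
theorem valueB_lt_one [IsProbabilityMeasure P] (hz : IsFilteredBrownian P F z)
    (hσ : 0 < p.σ) (hlam : 0 ≤ p.lam) (hmu : 0 ≤ p.mu)
    (hγ : 0 < p.γ) (hK : 0 < p.K) (j : Scenario) {E t : ℝ} (hE : 0 < E) (ht : 0 ≤ t)
    (htT : t ≤ p.T) (X y : ℝ) {S : ℝ} (hS : 0 < S) : p.valueB P F z j E t X y S < 1 := by
  unfold valueB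
  split_ifs
  · obtain ⟨ε, hε, h⟩ := exists_integral_outcome_le hz hσ hlam hmu hγ hK j hE ht htT X y hS
    rcases isEmpty_or_nonempty (p.Strategy P F z t X y S) with h' | h'
    · rw [Real.iSup_of_isEmpty]; exact one_pos
    · exact (ciSup_le h).trans_lt (by linarith)
  · linarith [Real.exp_pos (p.γ * E)]

end MarketParams

theorem mainTheorem10 {Ω : Type*} {mΩ : MeasurableSpace Ω} (P : Measure Ω)
    [IsProbabilityMeasure P] (F : Filtration ℝ≥0 mΩ) (z : ℝ≥0 → Ω → ℝ)
    (hz : IsFilteredBrownian P F z) (p : MarketParams)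
    (hσ : 0 < p.σ) (hlam : 0 ≤ p.lam) (hmu : 0 ≤ p.mu) (hmu' : p.mu < 1)
    (hγ : 0 < p.γ) (hK : 0 < p.K) (hT : 0 < p.T)
    (X₀ E₀ : ℝ) (hE₀ : 0 < E₀) :
    ∃ M : ℝ, 0 ≤ M ∧ ∀ j : Scenario, ∀ t ∈ Set.Icc 0 p.T, ∀ y S : ℝ, 0 < S →
      0 < p.reducedB P F z j E₀ X₀ t y S ∧ p.reducedB P F z j E₀ X₀ t y S ≤ M := by
  -- The first factor bounds `1 - V`; the second bounds `exp (γ X₀ / δ(T,t))`, since `1 / δ(T,t) =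
  -- exp (r (T - t)) ≤ exp (|r| T)`.
  refine ⟨Real.exp (p.γ * E₀) * Real.exp (p.γ * (|X₀| * Real.exp (|p.r| * p.T))),
    by positivity, fun j t ht y S hS ↦ ?_⟩
  have hlt := MarketParams.valueB_lt_one hz hσ hlam hmu hγ hK j hE₀ ht.1 ht.2 X₀ y hS
  have hge := MarketParams.one_sub_exp_le_valueB (P := P) (F := F) (z := z) hlam hmu' hγ hK j hE₀
    ht.2 X₀ y hS
  unfold MarketParams.reducedB
  refine ⟨div_pos (by linarith) (Real.exp_pos _), ?_⟩
  rw [Real.exp_neg, div_inv_eq_mul]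
  refine mul_le_mul (by linarith) (Real.exp_le_exp.2 (mul_le_mul_of_nonneg_left ?_ hγ.le))
    (Real.exp_pos _).le (Real.exp_pos _).le
  rw [MarketParams.discount, Real.exp_neg, div_inv_eq_mul]
  refine mul_le_mul (le_abs_self _) (Real.exp_le_exp.2 ?_) (Real.exp_pos _).le (abs_nonneg _)
  exact mul_le_mul (le_abs_self _) (by linarith [ht.1]) (by linarith [ht.2]) (abs_nonneg _)
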